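/- **Setting.** Let $\Omega$ and $A$ be finite sets of states and actions, $p\in\Delta(\Omega)$ a prior with $p_\omega>0$ for all $\omega$, $u,v:A\times\Omega\to\mathbb R$ the utilities of the receiver and the sender, $\nu$ a probability distribution on $\{1,2,\dots\}$, and $S$ a measurable space of signals with measurable singletons and at least $|\Omega|$ elements. An *experiment* is a map $\pi:\Omega\to\Delta(S)$; it is *fully revealing* if, for some injective $f:\Omega\to S$, $\pi(\omega)$ is the point mass at $f(\omega)$ for every $\omega$. **Disclosure game.** Nature draws the sender's type $k\sim\nu$, which only the sender observes. The sender chooses $k$ experiments $\pi_1,\dots,\pi_k$; the state $\omega\sim p$ is realized and is not observed by the sender; outcomes $s_i\sim\pi_i(\omega)$ are drawn independently given $\omega$. The sender observes the outcomes and discloses the multiset $T$ of the pairs $(\pi_i,s_i)$, $i\in B$, for a set $B\subseteq\{1,\dots,k\}$ that she chooses as a measurable function of the outcomes. The receiver observes only $T$ and chooses an action. The sender's strategy $\tau$ may be mixed (for each $k$ in the support of $\nu$, a discrete distribution $\tau_k$ over pure strategies). The receiver has a belief system $T\mapsto\rho(T)\in\Delta(\Omega)$ and a possibly mixed strategy $T\mapsto\sigma(T)\in\Delta(A)$,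 both measurable and defined for all finite multisets $T$ of pairs (experiment, signal) of size at most $\sup\operatorname{supp}\nu$; here a set of evidence is measurable if, for every $k$ in the support of $\nu$, every $(\pi_1,\dots,\pi_k)$ and every $B\subseteq\{1,\dots,k\}$, the set of $(s_1,\dots,s_k)$ for which the disclosed multiset belongs to it is measurable in $S^k$. The profile $(\tau,(\rho,\sigma))$ is a *weak perfect Bayesian equilibrium* (wPBE) if, for each $k$ in the support of $\nu$, $\tau_k$ maximizes the expected utility of type $k$ given $\sigma$; $\rho(T)$ is the conditional distribution of the state given $T$ for almost every $T$ under the distribution induced by $\tau$; and $\sigma(T)$ is a best reply of the receiver to the belief $\rho(T)$ for almost every such $T$. **Bayesian persuasion.** A (direct) policy is a $P\in\Delta(A\times\Omega)$ with marginal $p$ on $\Omega$ such that $\sum_\omega P(a,\omega)u(a',\omega)\le\sum_\omega P(a,\omega)u(a,\omega)$ for all $a,a'\in A$. A Bayesian persuasion policy is one that maximizes $\sum_{a,\omega}P(a,\omega)v(a,\omega)$ among all such policies, and this maximum is the Bayesian persuasion (full-commitment) utility. Assume that there is a unique Bayesian persuasion policy $P$, and let $\tilde A$ be the set of actions with positive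 probability under $P$. **Theorem.** Suppose that the receiver has a punishing action with respect to $\tilde A$: there are $q\in\Delta(\Omega)$ and $x\in\Delta(A)$ such that $x$ is a best reply of the receiver to the belief $q$ and $\sum_{a}x(a)v(a,\omega)\le v(b,\omega)$ for all $b\in\tilde A$ and $\omega\in\Omega$. Then there is a wPBE in which the sender's ex ante expected utility equals the Bayesian persuasion utility. Moreover, the wPBE can be chosen such that $\sigma(T)$ is a best reply to $\rho(T)$ for every $T$, and such that there are an experiment $\pi$ and a fully revealing experiment $\pi'$ with the following property: for every $k$ in the support of $\nu$, each pure strategy to which $\tau_k$ assigns positive probability either runs $k$ copies of $\pi$, or (only if $k\ge2$) runs $k-1$ copies of $\pi$ and one copy of $\pi'$. -/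

import Mathlib

open MeasureTheory
open scoped ENNReal

noncomputable section

namespace Disclosure

/-- The primitives of the model apart from the signal space: a full-support common prior on the
states, the utilities `u` of the receiver and `v` of the sender, and the distribution `ν` on
`{1, 2, …}` of the number of experiments that the sender can run (her type). -/
structure Game (Ω A : Type*) [Fintype Ω] where
  prior : stdSimplex ℝ Ω
  prior_pos : ∀ ω, 0 < prior.1 ω
  u : A → Ω → ℝ
  v : A → Ω → ℝ
  ν : PMF ℕ+

section Receiver

variable {Ω A : Type*} [Fintype Ω] [Fintype A]

/-- Expected utility in state `ω` of the mixed action `x`. -/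
def mixedUtility (w : A → Ω → ℝ) (x : stdSimplex ℝ A) (ω : Ω) : ℝ :=
  ∑ a, x.1 a * w a ω

/-- The mixed action `x` maximizes the receiver's expected utility under the belief `q`. -/
def IsBestReply (u : A → Ω → ℝ) (q : stdSimplex ℝ Ω) (x : stdSimplex ℝ A) : Prop :=
  ∀ y : stdSimplex ℝ A,
    ∑ ω, q.1 ω * mixedUtility u y ω ≤ ∑ ω, q.1 ω * mixedUtility u x ω

/-- The receiver has a punishing action with respect to the set `B` of actions. -/
def HasPunishingAction (G : Game Ω A) (B : Set A) : Prop :=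
  ∃ (q : stdSimplex ℝ Ω) (x : stdSimplex ℝ A), IsBestReply G.u q x ∧
    ∀ b ∈ B, ∀ ω, mixedUtility G.v x ω ≤ G.v b ω

/-- `P` is an obedient direct recommendation policy: a distribution on `A × Ω` whose marginal on
`Ω` is the prior, such that following the recommendation is optimal for the receiver. -/
def IsObedientPolicy (G : Game Ω A) (P : stdSimplex ℝ (A × Ω)) : Prop :=
  (∀ ω, ∑ a, P.1 (a, ω) = G.prior.1 ω) ∧
    ∀ a a', ∑ ω, P.1 (a, ω) * G.u a' ω ≤ ∑ ω, P.1 (a, ω) * G.u a ω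

/-- The sender's expected utility under a direct recommendation policy. -/
def policyValue (G : Game Ω A) (P : stdSimplex ℝ (A × Ω)) : ℝ :=
  ∑ a, ∑ ω, P.1 (a, ω) * G.v a ω

/-- `P` is a Bayesian persuasion policy, i.e. an optimal one under full commitment. -/
def IsPersuasionPolicy (G : Game Ω A) (P : stdSimplex ℝ (A × Ω)) : Prop :=
  IsObedientPolicy G P ∧ ∀ P', IsObedientPolicy G P' → policyValue G P' ≤ policyValue G P

/-- The actions that are recommended with positive probability under `P`. -/
def usedActions (P : stdSimplex ℝ (A × Ω)) : Set A :=
  {a | 0 < ∑ ω, P.1 (a, ω)}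

end Receiver

section Evidence

/-- An experiment maps each state to a probability distribution of signals. -/
abbrev Experiment (Ω S : Type*) [MeasurableSpace S] := Ω → ProbabilityMeasure S

/-- The experiment fully reveals the state: distinct states produce distinct sure signals. -/
def Experiment.IsFullyRevealing {Ω S : Type*} [MeasurableSpace S] (π : Experiment Ω S) : Prop :=
  ∃ f : Ω ↪ S, ∀ ω, (π ω : Measure S) = Measure.dirac (f ω)

/-- What the receiver can be shown: finite collections, with repetition allowed, of pairs of an
experiment and one of its outcomes, of a size that does not exceed the supremum of the support
of `ν`. -/
def Evidence (Ω S : Type*) [MeasurableSpace S] (ν : PMF ℕ+) :=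
  {T : Multiset (Experiment Ω S × S) // ∃ k ∈ ν.support, T.card ≤ (k : ℕ)}

variable {Ω A S : Type*} [MeasurableSpace S]

/-- The evidence seen by the receiver when type `k` runs the experiments `π`, obtains the outcomes
`s` and discloses those with indices in `B`. -/
def reveal {ν : PMF ℕ+} (k : ν.support) (π : Fin k.1 → Experiment Ω S) (B : Finset (Fin k.1))
    (s : Fin k.1 → S) : Evidence Ω S ν :=
  ⟨B.val.map fun i => (π i, s i), k.1, k.2, by
    simpa using (Finset.card_le_univ B).trans_eq (Fintype.card_fin _)⟩

/-- A set of evidence is measurable iff, for every type, every choice of experiments and every set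
of disclosed indices, it corresponds to a measurable set of outcomes. -/
instance (ν : PMF ℕ+) : MeasurableSpace (Evidence Ω S ν) :=
  ⨅ (k : ν.support) (π : Fin k.1 → Experiment Ω S) (B : Finset (Fin k.1)),
    MeasurableSpace.map (reveal k π B) MeasurableSpace.pi

/-- A pure strategy of the sender of type `k`: which experiments to run, and which outcomes to
disclose as a (measurable) function of the realized outcomes. -/
structure PureStrategy (Ω S : Type*) [MeasurableSpace S] (k : ℕ) where
  experiment : Fin k → Experiment Ω S
  disclosed : (Fin k → S) → Finset (Fin k)
  measurable_disclosed : ∀ B, MeasurableSet (disclosed ⁻¹' {B})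

/-- A (possibly mixed) strategy of the sender: for each type in the support of `ν`, a discrete
probability distribution over pure strategies. -/
abbrev SenderStrategy (Ω S : Type*) [MeasurableSpace S] (ν : PMF ℕ+) :=
  (k : ν.support) → PMF (PureStrategy Ω S k.1)

/-- The evidence that results from a pure strategy and the realized outcomes. -/
def PureStrategy.evidence {ν : PMF ℕ+} {k : ν.support} (ψ : PureStrategy Ω S k.1)
    (s : Fin k.1 → S) : Evidence Ω S ν :=
  reveal k ψ.experiment (ψ.disclosed s) s

/-- The law of the outcomes in state `ω`: they are independent conditionally on the state. -/
def PureStrategy.outcomeLaw {k : ℕ} (ψ : PureStrategy Ω S k) (ω : Ω) : Measure (Fin k → S) :=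
  Measure.pi fun i => (ψ.experiment i ω : Measure S)

theorem measurable_reveal {ν : PMF ℕ+} (k : ν.support) (π : Fin k.1 → Experiment Ω S)
    (B : Finset (Fin k.1)) : Measurable (reveal k π B) := by
  rw [measurable_iff_le_map]
  exact (iInf_le _ k).trans ((iInf_le _ π).trans (iInf_le _ B))

theorem PureStrategy.measurable_evidence {ν : PMF ℕ+} {k : ν.support}
    (ψ : PureStrategy Ω S k.1) : Measurable (ψ.evidence (ν := ν)) := by
  intro E hE
  have : ψ.evidence (ν := ν) ⁻¹' E =
      ⋃ B, ψ.disclosed ⁻¹' {B} ∩ reveal k ψ.experiment B ⁻¹' E := by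
    ext s
    simp [PureStrategy.evidence]
  rw [this]
  exact MeasurableSet.iUnion fun B =>
    (ψ.measurable_disclosed B).inter (measurable_reveal k _ B hE)

end Evidence

section Equilibrium

variable {Ω A S : Type*} [Fintype Ω] [Fintype A] [MeasurableSpace S]

/-- The receiver's belief system `ρ` and his (possibly mixed) strategy `σ`. -/
structure Assessment (Ω A S : Type*) [Fintype Ω] [Fintype A] [MeasurableSpace S]
    (ν : PMF ℕ+) where
  ρ : Evidence Ω S ν → stdSimplex ℝ Ω
  σ : Evidence Ω S ν → stdSimplex ℝ A
  measurable_ρ : Measurable ρ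
  measurable_σ : Measurable σ

/-- The sender's expected utility from a pure strategy of type `k`. -/
def purePayoff (G : Game Ω A) (R : Assessment Ω A S G.ν) {k : G.ν.support}
    (ψ : PureStrategy Ω S k.1) : ℝ :=
  ∑ ω, G.prior.1 ω * ∫ s, mixedUtility G.v (R.σ (ψ.evidence s)) ω ∂(ψ.outcomeLaw ω)

/-- The sender's expected utility from a mixed strategy of type `k`. -/
def typePayoff (G : Game Ω A) (R : Assessment Ω A S G.ν) {k : G.ν.support}
    (m : PMF (PureStrategy Ω S k.1)) : ℝ :=
  ∑' ψ, (m ψ).toReal * purePayoff G R ψ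

/-- The sender's ex ante expected utility. -/
def senderPayoff (G : Game Ω A) (R : Assessment Ω A S G.ν) (τ : SenderStrategy Ω S G.ν) : ℝ :=
  ∑' k : G.ν.support, (G.ν k.1).toReal * typePayoff G R (τ k)

/-- The measure `E ↦ ℙ_τ(E × {ω})`, where `ℙ_τ` is the joint distribution of evidence and state
that the sender's strategy `τ` induces. -/
def jointLaw (G : Game Ω A) (τ : SenderStrategy Ω S G.ν) (ω : Ω) : Measure (Evidence Ω S G.ν) :=
  ENNReal.ofReal (G.prior.1 ω) • Measure.sum fun k : G.ν.support =>
    G.ν k.1 • Measure.sum fun ψ => τ k ψ • (ψ.outcomeLaw ω).map ψ.evidence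

/-- The distribution of evidence that the sender's strategy `τ` induces. -/
def evidenceLaw (G : Game Ω A) (τ : SenderStrategy Ω S G.ν) : Measure (Evidence Ω S G.ν) :=
  ∑ ω, jointLaw G τ ω

/-- Weak perfect Bayesian equilibrium. The second clause says that `ρ(T)` is the conditional
distribution `ℙ_τ(· | T)` of the state for almost every `T`. -/
structure IsWPBE (G : Game Ω A) (τ : SenderStrategy Ω S G.ν) (R : Assessment Ω A S G.ν) :
    Prop where
  sender_optimal : ∀ (k : G.ν.support) (m : PMF (PureStrategy Ω S k.1)),
    typePayoff G R m ≤ typePayoff G R (τ k)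
  bayes : ∀ (ω : Ω) (E : Set (Evidence Ω S G.ν)), MeasurableSet E →
    jointLaw G τ ω E = ∫⁻ T in E, ENNReal.ofReal ((R.ρ T).1 ω) ∂(evidenceLaw G τ)
  receiver_optimal : ∀ᵐ T ∂(evidenceLaw G τ), IsBestReply G.u (R.ρ T) (R.σ T)

end Equilibrium

end Disclosure

end

/-! The receiver is made to reply only to evidence that is a single outcome of one experiment `π`:
such an outcome is read as a recommendation, with the belief and the reply that `P` prescribes, and
all other evidence is met with the punishing action. Uniqueness of `P` makes its rows linearly
independent, so at most `|Ω|` actions are used and they can be coded as signals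
(`nonempty_usedActions_embedding`).

Against such a receiver, running an experiment other than `π` can only serve to learn the state. One
experiment is enough for full information, so every deviation is dominated by a plan: run `π` only
and select an outcome, or give up one slot for a fully revealing experiment and select among the
rest knowing the state (`purePayoff_le_of_plan_le`). For each type there are finitely many plans.

The difficulty is that selection distorts the signal law. If `π` has law `x ω`, each type discloses
a favourable outcome, and the receiver's beliefs are correct only if the law averaged over types is
the conditional law `y ω` of recommendations under `P`. Hence `x` has to be found such that optimal
selection from `x` yields `y` (`exists_optimal_mixture_eq`). A signal absent from `x ω` can never be
selected, so for continuous weights on plans the map from `x` to the averaged law preserves the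
faces of a product of simplices; by Brouwer it is onto. Weights on `ε`-optimal plans are continuous
in `x`, and a compactness limit `ε → 0` gives exact optimality. As the disclosed recommendation then
has the joint law `P` with the state, Bayes' rule and the value follow.

Brouwer's theorem comes from the analytic no-retraction argument: the volume of the image of the
ball under `x + t • g x`, as given by the integral of the Jacobian, is polynomial in `t` and
constant for small `t`, but would vanish at `t = 1` for a retraction. -/

noncomputable section

namespace Disclosure

/-! ### Brouwer's theorem via the absence of a `C¹` retraction. -/

section Brouwer

open Polynomial in
/-- Determinants are polynomial along affine lines, so they are recovered from interpolation at
`finrank + 1` nodes. -/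
theorem det_one_add_smul_eq_sum_interpolation {E : Type*} [AddCommGroup E] [Module ℝ E]
    [FiniteDimensional ℝ E] (g : E →ₗ[ℝ] E) (s : Finset ℝ)
    (hs : Module.finrank ℝ E < s.card) (t : ℝ) :
    LinearMap.det (1 + t • g) =
      ∑ i ∈ s, LinearMap.det (1 + i • g) * (Lagrange.basis s id i).eval t := by
  classical
  let b := Module.finBasis ℝ E
  obtain ⟨M, hM⟩ : ∃ M, M = LinearMap.toMatrix b b g := ⟨_, rfl⟩
  let q : ℝ[X] := ((X : ℝ[X]) • M.map C + (1 : Matrix _ _ ℝ).map C).det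
  have hq : ∀ t, q.eval t = LinearMap.det (1 + t • g) := by
    intro t
    rw [← LinearMap.det_toMatrix b, map_add, map_smul, LinearMap.toMatrix_one, ← hM, add_comm]
    rw [← Polynomial.coe_evalRingHom, RingHom.map_det]
    congr 1
    ext i j
    rcases eq_or_ne i j with rfl | h
    · simp; ring
    · simp [h]; ring
  have hdeg : q.degree < s.card := by
    refine lt_of_le_of_lt Polynomial.degree_le_natDegree ?_
    have := Polynomial.natDegree_det_X_add_C_le M 1
    rw [Fintype.card_fin] at this
    exact_mod_cast this.trans_lt hs
  have := Lagrange.eq_interpolate (s := s) (v := id) (Set.injOn_id _) hdeg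
  rw [← hq, this, Lagrange.interpolate_apply, Polynomial.eval_finsetSum]
  refine Finset.sum_congr rfl fun i _ => ?_
  rw [← hq, Polynomial.eval_mul, Polynomial.eval_C, id]

variable {E : Type*} [NormedAddCommGroup E]

/-- Extending by zero outside of a ball a map that vanishes on the sphere preserves the Lipschitz
constant. -/
theorem lipschitzWith_indicator_closedBall [NormedSpace ℝ E] {g : E → E} {C : NNReal} {R : ℝ}
    (hR : 0 < R)
    (hg : LipschitzOnWith C g (Metric.closedBall 0 R)) (h0 : ∀ x, ‖x‖ = R → g x = 0) :
    LipschitzWith C ((Metric.closedBall 0 R).indicator g) := by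
  have key : ∀ x y : E, ‖x‖ ≤ R → R < ‖y‖ → ‖g x‖ ≤ C * ‖x - y‖ := by
    intro x y hx hy
    -- Here `z` is the radial projection of `x` to the sphere; at `x = 0` any direction does, and
    -- `y` supplies one.
    obtain ⟨z, hz, hxz⟩ : ∃ z : E, ‖z‖ = R ∧ ‖x - z‖ = R - ‖x‖ := by
      rcases eq_or_ne x 0 with rfl | hx0
      · refine ⟨(R / ‖y‖) • y, ?_, ?_⟩ <;>
        · have : 0 < ‖y‖ := hR.trans hy
          simp [norm_smul, abs_of_pos hR, this.ne']
      · have hx1 : 0 < ‖x‖ := norm_pos_iff.2 hx0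
        refine ⟨(R / ‖x‖) • x, ?_, ?_⟩
        · simp [norm_smul, abs_of_pos hR, hx1.ne']
        · have : x - (R / ‖x‖) • x = (1 - R / ‖x‖) • x := by rw [sub_smul, one_smul]
          rw [this, norm_smul, Real.norm_of_nonpos]
          · field_simp
            ring
          · rw [sub_nonpos, one_le_div hx1]; exact hx
    have h1 := hg.norm_sub_le (x := x) (y := z) (by simpa using hx) (by simp [hz])
    rw [h0 z hz, sub_zero, hxz] at h1
    refine h1.trans (mul_le_mul_of_nonneg_left ?_ C.2)
    have := norm_sub_norm_le y x
    rw [norm_sub_rev] at this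
    linarith
  refine LipschitzWith.of_dist_le_mul fun x y => ?_
  rw [dist_eq_norm, dist_eq_norm]
  by_cases hx : ‖x‖ ≤ R <;> by_cases hy : ‖y‖ ≤ R
  · rw [Set.indicator_of_mem (by simpa using hx), Set.indicator_of_mem (by simpa using hy)]
    exact hg.norm_sub_le (by simpa using hx) (by simpa using hy)
  · rw [Set.indicator_of_mem (by simpa using hx), Set.indicator_of_notMem (by simpa using hy),
      sub_zero]
    exact key x y hx (not_le.1 hy)
  · rw [Set.indicator_of_notMem (by simpa using hx), Set.indicator_of_mem (by simpa using hy),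
      zero_sub, norm_neg, norm_sub_rev]
    exact key y x hy (not_le.1 hx)
  · rw [Set.indicator_of_notMem (by simpa using hx), Set.indicator_of_notMem (by simpa using hy)]
    simp only [sub_zero, norm_zero]
    positivity

variable [InnerProductSpace ℝ E] [FiniteDimensional ℝ E]

/-- Small perturbations of the identity that vanish on the sphere map the ball onto itself. -/
theorem image_closedBall_add_smul {g : E → E} {C : NNReal} {R : ℝ} (hR : 0 < R)
    (hg : LipschitzOnWith C g (Metric.closedBall 0 R)) (h0 : ∀ x, ‖x‖ = R → g x = 0)
    {t : NNReal} (ht : t * C < 1) :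
    Set.InjOn (fun x => x + (t : ℝ) • g x) (Metric.closedBall 0 R) ∧
    (fun x => x + (t : ℝ) • g x) '' Metric.closedBall 0 R = Metric.closedBall 0 R := by
  set B : Set E := Metric.closedBall 0 R
  -- Extended by the identity, the map is globally a Lipschitz perturbation of the identity with
  -- constant below one, hence bijective; a bijection that fixes every point outside `B` maps `B`
  -- onto itself.
  let F : E → E := fun x => x + (t : ℝ) • B.indicator g x
  have hF : ApproximatesLinearOn F ((ContinuousLinearEquiv.refl ℝ E : E ≃L[ℝ] E) : E →L[ℝ] E)
      Set.univ (t * C) := by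
    intro x _ y _
    have h := (lipschitzWith_indicator_closedBall hR hg h0).norm_sub_le x y
    have : F x - F y - (x - y) = (t : ℝ) • (B.indicator g x - B.indicator g y) := by
      simp only [F, smul_sub]; abel
    simp only [ContinuousLinearEquiv.coe_refl, ContinuousLinearMap.coe_id', id_eq]
    rw [this, norm_smul, NNReal.norm_eq]
    push_cast
    rw [mul_assoc]
    exact mul_le_mul_of_nonneg_left h t.2
  have hc : Subsingleton E ∨
      t * C < ‖(((ContinuousLinearEquiv.refl ℝ E).symm : E ≃L[ℝ] E) : E →L[ℝ] E)‖₊⁻¹ := by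
    rcases subsingleton_or_nontrivial E with h | h
    · exact Or.inl h
    · refine Or.inr ?_
      simpa using ht
  have hinj : Function.Injective F := Set.injOn_univ.1 (hF.injOn hc)
  have hsurj : Function.Surjective F := hF.surjective hc
  have hin : ∀ x ∈ B, F x = x + (t : ℝ) • g x := fun x hx => by
    simp only [F, Set.indicator_of_mem hx]
  have hout : ∀ x ∉ B, F x = x := fun x hx => by
    simp only [F, Set.indicator_of_notMem hx, smul_zero, add_zero]
  have himg : F '' B = B := by
    apply Set.Subset.antisymm
    · rintro _ ⟨x, hx, rfl⟩
      by_contra h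
      exact h ((hinj (hout _ h)).symm ▸ hx)
    · intro y hy
      obtain ⟨x, rfl⟩ := hsurj y
      refine ⟨x, ?_, rfl⟩
      by_contra h
      exact h (hout x h ▸ hy)
  refine ⟨fun x hx y hy hxy => hinj ?_, ?_⟩
  · rw [hin x hx, hin y hy]; exact hxy
  · rw [← Set.image_congr hin, himg]

/-- There is no `C¹` retraction of a ball onto its boundary sphere. -/
theorem not_contDiff_retraction_sphere {R : ℝ} (hR : 0 < R) {r : E → E} (hr : ContDiff ℝ 1 r)
    (hnorm : ∀ x, ‖r x‖ = R) (hid : ∀ x, ‖x‖ = R → r x = x) : False := by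
  borelize E
  let μ : Measure E := Measure.addHaar
  set B : Set E := Metric.closedBall 0 R with hB
  have hBc : IsCompact B := isCompact_closedBall _ _
  let g : E → E := fun x => r x - x
  have hg : ContDiff ℝ 1 g := hr.sub contDiff_id
  have hgd : ∀ x, HasFDerivAt g (fderiv ℝ g x) x := fun x =>
    (hg.differentiable one_ne_zero x).hasFDerivAt
  have hgc : Continuous (fderiv ℝ g) := hg.continuous_fderiv one_ne_zero
  obtain ⟨C, hC⟩ : ∃ C, LipschitzOnWith C g B :=
    hg.contDiffOn.exists_lipschitzOnWith one_ne_zero (convex_closedBall _ _) hBc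
  -- The Jacobian of the homotopy `x + t • g x` from the identity to `r`.
  let D : ℝ → E → ℝ := fun t x => LinearMap.det (1 + t • (fderiv ℝ g x : E →ₗ[ℝ] E))
  have hD : Continuous fun z : ℝ × E => D z.1 z.2 := by
    have : ∀ z : ℝ × E, D z.1 z.2 =
        ((1 : E →L[ℝ] E) + z.1 • fderiv ℝ g z.2).det := fun z => rfl
    simp only [this]
    exact ContinuousLinearMap.continuous_det.comp (by fun_prop)
  have hDi : ∀ t, IntegrableOn (D t) B μ := fun t =>
    (hD.comp (Continuous.prodMk_right t)).continuousOn.integrableOn_compact hBc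
  -- Positivity at `t = 0` spreads to small `t` uniformly on the compact ball, which removes the
  -- absolute value in the change of variables.
  obtain ⟨δ, hδ, hpos⟩ : ∃ δ > 0, ∀ t : ℝ, |t| < δ → ∀ x ∈ B, 0 < D t x := by
    have ho : IsOpen {z : ℝ × E | 0 < D z.1 z.2} := isOpen_lt continuous_const hD
    obtain ⟨u, v, hu, -, hu0, hv, huv⟩ := generalized_tube_lemma (s := {(0 : ℝ)})
      isCompact_singleton hBc ho (by
        rintro ⟨t, x⟩ ⟨ht, -⟩
        obtain rfl : t = 0 := ht
        simp [D])
    obtain ⟨δ, hδ, hball⟩ := Metric.isOpen_iff.1 hu 0 (hu0 rfl)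
    exact ⟨δ, hδ, fun t ht x hx => huv (Set.mk_mem_prod (hball (by simpa using ht)) (hv hx))⟩
  have hvol : ∀ t : ℝ, 0 ≤ t → t < δ → t * C < 1 → ∫ x in B, D t x ∂μ = μ.real B := by
    intro t ht0 htδ htC
    obtain ⟨hinj, himg⟩ := image_closedBall_add_smul (t := ⟨t, ht0⟩) hR hC
      (fun x hx => by simp only [g, hid x hx, sub_self]) (by exact_mod_cast htC)
    have h1 := integral_image_eq_integral_abs_det_fderiv_smul (s := B) μ
      (f := fun x => x + t • g x) (f' := fun x => 1 + t • fderiv ℝ g x)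
      Metric.isClosed_closedBall.measurableSet
      (fun x _ => ((hasFDerivAt_id x).add ((hgd x).const_smul t)).hasFDerivWithinAt) hinj
      (fun _ => (1 : ℝ))
    have himg' : (fun x => x + t • g x) '' B = B := himg
    rw [himg'] at h1
    simp only [smul_eq_mul, mul_one, integral_const, measureReal_restrict_apply_univ] at h1
    rw [h1]
    refine setIntegral_congr_fun Metric.isClosed_closedBall.measurableSet fun x hx => ?_
    exact (abs_of_pos (hpos t (by rwa [abs_of_nonneg ht0]) x hx)).symm
  obtain ⟨η, hη, hη1, hη2⟩ : ∃ η : ℝ, 0 < η ∧ η ≤ δ ∧ η * C < 1 := by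
    refine ⟨min δ (C + 1 : ℝ)⁻¹, by positivity, min_le_left _ _, ?_⟩
    calc min δ (C + 1 : ℝ)⁻¹ * C ≤ (C + 1 : ℝ)⁻¹ * C := by gcongr; exact min_le_right _ _
      _ < 1 := by rw [inv_mul_lt_iff₀ (by positivity)]; linarith
  obtain ⟨s, hs, hcard⟩ := (Set.Ioo_infinite hη).exists_subset_card_eq (Module.finrank ℝ E + 1)
  have hsn : s.Nonempty := Finset.card_pos.1 (by omega)
  -- The value at `t = 1` is extrapolated from nodes in `(0, η)`, where the integral is already
  -- known; the Lagrange basis sums to one.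
  have hint : ∫ x in B, D 1 x ∂μ = μ.real B := by
    have : ∀ x, D 1 x = ∑ i ∈ s, D i x * (Lagrange.basis s id i).eval 1 := fun x =>
      det_one_add_smul_eq_sum_interpolation _ s (by omega) 1
    simp_rw [this]
    rw [integral_finsetSum _ fun i _ => (hDi i).mul_const _]
    have h2 : ∀ i ∈ s, ∫ x in B, D i x * (Lagrange.basis s id i).eval 1 ∂μ =
        μ.real B * (Lagrange.basis s id i).eval 1 := by
      intro i hi
      obtain ⟨hi0, hi1⟩ := hs hi
      rw [integral_mul_const, hvol i hi0.le (hi1.trans_le hη1)]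
      exact (mul_le_mul_of_nonneg_right hi1.le C.2).trans_lt hη2
    rw [Finset.sum_congr rfl h2, ← Finset.mul_sum, ← Polynomial.eval_finsetSum,
      Lagrange.sum_basis (Set.injOn_id _) hsn, Polynomial.eval_one, mul_one]
  -- Since `‖r‖` is constant, the range of the derivative of `r` is orthogonal to `r x ≠ 0`, so the
  -- derivative is not surjective.
  have hzero : ∀ x, D 1 x = 0 := by
    intro x
    by_contra hne
    have hr' : HasFDerivAt r (1 + fderiv ℝ g x) x := by
      have := (hasFDerivAt_id x).add (hgd x)
      refine this.congr_of_eventuallyEq (Filter.Eventually.of_forall fun y => ?_)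
      simp [g]
    have h2 : HasFDerivAt (fun y => ‖r y‖ ^ 2) (2 • (innerSL ℝ (r x)).comp (1 + fderiv ℝ g x)) x :=
      hr'.norm_sq
    have h3 : HasFDerivAt (fun y => ‖r y‖ ^ 2) (0 : E →L[ℝ] ℝ) x := by
      simp only [hnorm]; exact hasFDerivAt_const _ _
    have h4 := h2.unique h3
    have hsurj : Function.Surjective ⇑(1 + (1 : ℝ) • (fderiv ℝ g x : E →ₗ[ℝ] E) : E →ₗ[ℝ] E) :=
      (LinearMap.equivOfDetNeZero _ hne).surjective
    obtain ⟨h, hh⟩ := hsurj (r x)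
    have h5 := DFunLike.congr_fun h4 h
    have h6 : (1 + fderiv ℝ g x) h = r x := by simpa using hh
    simp only [_root_.smul_apply, ContinuousLinearMap.comp_apply, h6,
      innerSL_apply_apply, real_inner_self_eq_norm_sq, hnorm, _root_.zero_apply] at h5
    simp [hR.ne'] at h5
  have hpos : 0 < μ.real B :=
    ENNReal.toReal_pos (Metric.measure_closedBall_pos μ 0 hR).ne' hBc.measure_lt_top.ne
  simp [hzero] at hint
  exact hpos.ne hint

/-- **Brouwer's fixed point theorem** for bounded continuous self-maps of a Euclidean space. -/
theorem exists_fixedPoint_of_bounded {f : E → E} (hf : Continuous f) {R : ℝ}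
    (hR : ∀ x, ‖f x‖ ≤ R) : ∃ x, f x = x := by
  by_contra! hne
  have hR0 : 0 ≤ R := (norm_nonneg _).trans (hR 0)
  -- A cutoff equal to one for `‖x‖ ≤ R` and to zero for `‖x‖ ≥ R + 1`. A zero of `x - l x • f x`
  -- has norm at most `R`, where it would be a fixed point of `f`.
  let l : E → ℝ := fun x => max 0 (min 1 (R + 1 - ‖x‖))
  have hl0 : ∀ x, 0 ≤ l x := fun x => le_max_left _ _
  have hl1 : ∀ x, l x ≤ 1 := fun x => max_le zero_le_one (min_le_left _ _)
  let F : E → E := fun x => x - l x • f x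
  have hF : Continuous F := by fun_prop
  have hF0 : ∀ x, F x ≠ 0 := by
    intro x hx
    have hx' : x = l x • f x := sub_eq_zero.1 hx
    rcases le_or_gt ‖x‖ R with h | h
    · have : l x = 1 := by
        have : min 1 (R + 1 - ‖x‖) = 1 := min_eq_left (by linarith)
        simp only [l, this]; simp
      rw [this, one_smul] at hx'
      exact hne x hx'.symm
    · have : ‖x‖ ≤ R := by
        rw [hx', norm_smul, Real.norm_of_nonneg (hl0 x)]
        exact (mul_le_of_le_one_left (norm_nonneg _) (hl1 x)).trans (hR x)
      linarith
  have hFid : ∀ x, R + 1 < ‖x‖ → F x = x := by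
    intro x hx
    have : l x = 0 := max_eq_left ((min_le_right _ _).trans (by linarith))
    simp [F, this]
  -- An error below `‖F x‖` keeps `G` away from zero, and `G` is still the identity on the sphere of
  -- radius `R + 2`; normalizing it gives the forbidden retraction.
  obtain ⟨G, hG, hGF, hGS, -⟩ := hF.exists_contDiff_approx_and_eqOn (n := 1)
    (ε := fun x => ‖F x‖) hF.norm (fun x => norm_pos_iff.2 (hF0 x))
    (S := {x | R + 2 ≤ ‖x‖}) (U := {x | R + 1 < ‖x‖})
    (isClosed_le continuous_const continuous_norm)
    ((isOpen_lt continuous_const continuous_norm).mem_nhdsSet.2 fun x hx =>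
      lt_of_lt_of_le (by linarith : R + 1 < R + 2) hx)
    (contDiffOn_id.congr hFid)
  have hG0 : ∀ x, G x ≠ 0 := fun x h => by
    have := hGF x
    rw [h, dist_zero_left] at this
    exact lt_irrefl _ this
  refine not_contDiff_retraction_sphere (R := R + 2) (by linarith)
    (r := fun x => ((R + 2) / ‖G x‖) • G x) ?_ ?_ ?_
  · exact (contDiff_const.div (hG.norm ℝ hG0) fun x => norm_ne_zero_iff.2 (hG0 x)).smul hG
  · intro x
    have := norm_ne_zero_iff.2 (hG0 x)
    rw [norm_smul, norm_div, norm_norm, Real.norm_of_nonneg (by linarith)]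
    field_simp
  · intro x hx
    have : G x = x := (hGS (by simp [hx])).trans (hFid x (by linarith))
    simp only [this, hx]
    rw [div_self (by linarith), one_smul]

end Brouwer

/-! ### Fixed points and surjectivity on products of simplices. -/

section Simplices

variable {Ω I : Type*} [Fintype Ω] [Fintype I]

/-- A continuous map from functions to the simplex which fixes the simplex. -/
def simplexRetraction [Nonempty I] (z : I → ℝ) : stdSimplex ℝ I :=
  -- Missing mass is spread uniformly and excess mass is divided out; at most one correction is
  -- active.
  ⟨fun a => (max (z a) 0 + max (1 - ∑ b, max (z b) 0) 0 / Fintype.card I) /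
      max 1 (∑ b, max (z b) 0),
    fun a => div_nonneg (add_nonneg (le_max_right _ _)
      (div_nonneg (le_max_right _ _) (Nat.cast_nonneg _))) (zero_le_one.trans (le_max_left _ _)), by
    have hc : (Fintype.card I : ℝ) ≠ 0 := by exact_mod_cast Fintype.card_ne_zero
    rw [← Finset.sum_div, Finset.sum_add_distrib, Finset.sum_const, Finset.card_univ,
      nsmul_eq_mul, mul_div_cancel₀ _ hc]
    set t := ∑ b, max (z b) 0
    rcases le_total t 1 with h | h
    · rw [max_eq_left (by linarith : (0 : ℝ) ≤ 1 - t), max_eq_left h]; ring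
    · rw [max_eq_right (by linarith : 1 - t ≤ (0 : ℝ)), max_eq_right h, add_zero,
        div_self (by linarith)]⟩

theorem continuous_simplexRetraction [Nonempty I] :
    Continuous (simplexRetraction : (I → ℝ) → stdSimplex ℝ I) := by
  refine Continuous.subtype_mk (continuous_pi fun a => ?_) _
  refine Continuous.div (by fun_prop) (by fun_prop) fun z => ?_
  exact (zero_lt_one.trans_le (le_max_left _ _)).ne'

theorem simplexRetraction_coe [Nonempty I] (x : stdSimplex ℝ I) : simplexRetraction x.1 = x := by
  ext a
  have h1 : ∀ b, max (x.1 b) 0 = x.1 b := fun b => max_eq_left (x.2.1 b)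
  change (max (x.1 a) 0 + max (1 - ∑ b, max (x.1 b) 0) 0 / Fintype.card I) /
      max 1 (∑ b, max (x.1 b) 0) = x.1 a
  simp [h1, x.2.2]

/-- Brouwer's fixed point theorem for products of simplices. -/
theorem exists_fixedPoint_pi_stdSimplex [Nonempty I]
    {f : (Ω → stdSimplex ℝ I) → (Ω → stdSimplex ℝ I)} (hf : Continuous f) : ∃ x, f x = x := by
  let ret : EuclideanSpace ℝ (Ω × I) → (Ω → stdSimplex ℝ I) :=
    fun z ω => simplexRetraction fun a => z (ω, a)
  let emb : (Ω → stdSimplex ℝ I) → EuclideanSpace ℝ (Ω × I) :=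
    fun x => WithLp.toLp 2 fun p => (x p.1).1 p.2
  have hret : Continuous ret := continuous_pi fun ω =>
    continuous_simplexRetraction.comp (by fun_prop)
  have hemb : Continuous emb := by
    refine (PiLp.continuous_toLp 2 _).comp (continuous_pi fun p => ?_)
    exact (continuous_apply p.2).comp (continuous_subtype_val.comp (continuous_apply p.1))
  have hre : ∀ x, ret (emb x) = x := fun x => funext fun ω => simplexRetraction_coe (x ω)
  obtain ⟨R, hR⟩ : ∃ R, ∀ x, ‖emb x‖ ≤ R := by
    obtain ⟨R, hR⟩ := (isCompact_range hemb).isBounded.exists_norm_le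
    exact ⟨R, fun x => hR _ ⟨x, rfl⟩⟩
  obtain ⟨z, hz⟩ := exists_fixedPoint_of_bounded (f := fun z => emb (f (ret z)))
    (hemb.comp (hf.comp hret)) fun _ => hR _
  refine ⟨ret z, ?_⟩
  rw [← hre (f (ret z)), hz]

/-- The map that shifts mass in the direction of the positive part of `y - z`. -/
def simplexShift (x y z : stdSimplex ℝ I) : stdSimplex ℝ I :=
  ⟨fun a => (x.1 a + max (y.1 a - z.1 a) 0) / (1 + ∑ b, max (y.1 b - z.1 b) 0),
    fun a => div_nonneg (add_nonneg (x.2.1 a) (le_max_right _ _))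
      (add_nonneg zero_le_one (Finset.sum_nonneg fun _ _ => le_max_right _ _)), by
    rw [← Finset.sum_div, Finset.sum_add_distrib, x.2.2, div_self]
    exact (add_pos_of_pos_of_nonneg zero_lt_one
      (Finset.sum_nonneg fun _ _ => le_max_right _ _)).ne'⟩

/-- At a fixed point, `x a * D` is the positive part of `y a - z a`. If `D > 0`, then `y a < z a`
forces `x a = 0`, hence `z a = 0`, which is absurd; so `y - z` has one sign and total zero. The same
holds directly if `D = 0`. -/
theorem eq_of_simplexShift_eq {x y z : stdSimplex ℝ I} (hface : ∀ a, x.1 a = 0 → z.1 a = 0)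
    (h : simplexShift x y z = x) : z = y := by
  set D := ∑ b, max (y.1 b - z.1 b) 0 with hD
  have hD0 : 0 ≤ D := Finset.sum_nonneg fun _ _ => le_max_right _ _
  have hsum : ∑ a, (y.1 a - z.1 a) = 0 := by
    rw [Finset.sum_sub_distrib, y.2.2, z.2.2, sub_self]
  have hx : ∀ a, x.1 a * D = max (y.1 a - z.1 a) 0 := by
    intro a
    have h1 : (x.1 a + max (y.1 a - z.1 a) 0) / (1 + D) = x.1 a :=
      congrFun (congrArg Subtype.val h) a
    rw [div_eq_iff (by positivity)] at h1
    linarith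
  have hzero : ∀ a, y.1 a - z.1 a = 0 := by
    rcases hD0.eq_or_lt with h0 | hpos
    · have hle : ∀ a ∈ Finset.univ, y.1 a - z.1 a ≤ 0 := fun a _ => by
        have := hx a
        rw [← h0, mul_zero] at this
        exact (le_max_left _ _).trans this.symm.le
      exact fun a => (Finset.sum_eq_zero_iff_of_nonpos hle).1 hsum a (Finset.mem_univ a)
    · have hge : ∀ a ∈ Finset.univ, 0 ≤ y.1 a - z.1 a := fun a _ => by
        by_contra! hneg
        have h2 := hx a
        rw [max_eq_right hneg.le] at h2
        have h3 := hface a ((mul_eq_zero.1 h2).resolve_right hpos.ne')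
        have := y.2.1 a
        linarith
      exact fun a => (Finset.sum_eq_zero_iff_of_nonneg hge).1 hsum a (Finset.mem_univ a)
  ext a
  exact (sub_eq_zero.1 (hzero a)).symm

/-- A continuous self-map of a product of simplices that preserves all faces is surjective. -/
theorem surjective_of_preserves_faces [Nonempty I]
    {F : (Ω → stdSimplex ℝ I) → (Ω → stdSimplex ℝ I)} (hF : Continuous F)
    (hface : ∀ x ω a, (x ω).1 a = 0 → (F x ω).1 a = 0) : Function.Surjective F := by
  intro y
  have hc : ∀ (ω : Ω) (a : I), Continuous fun x : Ω → stdSimplex ℝ I => (x ω).1 a := fun ω a =>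
    (continuous_apply a).comp (continuous_subtype_val.comp (continuous_apply ω))
  have hcF : ∀ (ω : Ω) (a : I), Continuous fun x : Ω → stdSimplex ℝ I => (F x ω).1 a :=
    fun ω a => (hc ω a).comp hF
  obtain ⟨x, hx⟩ := exists_fixedPoint_pi_stdSimplex
    (f := fun x ω => simplexShift (x ω) (y ω) (F x ω)) (by
      refine continuous_pi fun ω => Continuous.subtype_mk (continuous_pi fun a => ?_) _
      refine Continuous.div ?_ ?_ fun x => ?_
      · exact (hc ω a).add ((continuous_const.sub (hcF ω a)).max continuous_const)
      · exact continuous_const.add (continuous_finsetSum _ fun b _ =>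
          (continuous_const.sub (hcF ω b)).max continuous_const)
      · exact (add_pos_of_pos_of_nonneg zero_lt_one
          (Finset.sum_nonneg fun _ _ => le_max_right _ _)).ne')
  exact ⟨x, funext fun ω => eq_of_simplexShift_eq (hface x ω) (congrFun hx ω)⟩

end Simplices

/-! ### Continuous weights on approximate maximizers. -/

section Selection

/-- Weights on the `ε`-maximizers of `u`. -/
def nearOptimalWeights {D : Type*} [Fintype D] [Nonempty D] (ε : ℝ) (hε : 0 < ε) (u : D → ℝ) :
    stdSimplex ℝ D :=
  ⟨fun d => max (u d - Finset.univ.sup' Finset.univ_nonempty u + ε) 0 /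
      ∑ d', max (u d' - Finset.univ.sup' Finset.univ_nonempty u + ε) 0,
    fun d => div_nonneg (le_max_right _ _) (Finset.sum_nonneg fun _ _ => le_max_right _ _), by
    rw [← Finset.sum_div, div_self]
    obtain ⟨d, -, hd⟩ := Finset.exists_mem_eq_sup' Finset.univ_nonempty u
    refine (Finset.sum_pos' (fun _ _ => le_max_right _ _) ⟨d, Finset.mem_univ d, ?_⟩).ne'
    rw [hd]
    simpa using hε⟩

variable {D : Type*} [Fintype D] [Nonempty D]

theorem sum_nearOptimalWeights_pos {ε : ℝ} (hε : 0 < ε) (u : D → ℝ) :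
    0 < ∑ d', max (u d' - Finset.univ.sup' Finset.univ_nonempty u + ε) 0 := by
  obtain ⟨d, -, hd⟩ := Finset.exists_mem_eq_sup' Finset.univ_nonempty u
  refine Finset.sum_pos' (fun _ _ => le_max_right _ _) ⟨d, Finset.mem_univ d, ?_⟩
  rw [hd]
  simpa using hε

theorem continuous_nearOptimalWeights {ε : ℝ} (hε : 0 < ε) :
    Continuous (nearOptimalWeights ε hε : (D → ℝ) → stdSimplex ℝ D) := by
  have hs : Continuous fun u : D → ℝ => Finset.univ.sup' Finset.univ_nonempty u :=
    Continuous.finset_sup'_apply _ fun d _ => continuous_apply d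
  refine Continuous.subtype_mk (continuous_pi fun d => ?_) _
  refine Continuous.div (by fun_prop) (by fun_prop) fun u => (sum_nearOptimalWeights_pos hε u).ne'

theorem lt_of_nearOptimalWeights_ne_zero {ε : ℝ} (hε : 0 < ε) {u : D → ℝ} {d : D}
    (h : (nearOptimalWeights ε hε u).1 d ≠ 0) (d' : D) : u d' - ε < u d := by
  by_contra! hle
  refine h ?_
  have h1 : u d' ≤ Finset.univ.sup' Finset.univ_nonempty u :=
    Finset.le_sup' u (Finset.mem_univ d')
  have h2 : max (u d - Finset.univ.sup' Finset.univ_nonempty u + ε) 0 = 0 :=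
    max_eq_right (by linarith)
  change max (u d - Finset.univ.sup' Finset.univ_nonempty u + ε) 0 / _ = 0
  rw [h2, zero_div]

end Selection

/-! ### Optimal mixtures that attain a prescribed law. -/

section Mixture

variable {Ω I K : Type*} [Fintype I] {D : K → Type*} [∀ k, Fintype (D k)]

theorem stdSimplex_apply_le_one (x : stdSimplex ℝ I) (a : I) : x.1 a ≤ 1 := by
  rw [← x.2.2]
  exact Finset.single_le_sum (fun b _ => x.2.1 b) (Finset.mem_univ a)

theorem sum_mul_stdSimplex_mem_Icc {D : Type*} [Fintype D] (m : stdSimplex ℝ D)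
    (z : D → Ω → stdSimplex ℝ I) (ω : Ω) (a : I) :
    ∑ d, m.1 d * (z d ω).1 a ∈ Set.Icc (0 : ℝ) 1 := by
  refine ⟨Finset.sum_nonneg fun d _ => mul_nonneg (m.2.1 d) ((z d ω).2.1 a), ?_⟩
  calc ∑ d, m.1 d * (z d ω).1 a ≤ ∑ d, m.1 d :=
        Finset.sum_le_sum fun d _ => mul_le_of_le_one_right (m.2.1 d)
          (stdSimplex_apply_le_one _ _)
    _ = 1 := m.2.2

/-- The bound does not depend on weights or laws, so it dominates the series over types in both the
continuity and the limit arguments. -/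
theorem norm_mul_sum_mul_stdSimplex_le {l : ℝ} (hl : 0 ≤ l) {D : Type*} [Fintype D]
    (m : stdSimplex ℝ D) (z : D → Ω → stdSimplex ℝ I) (ω : Ω) (a : I) :
    ‖l * ∑ d, m.1 d * (z d ω).1 a‖ ≤ l := by
  obtain ⟨h0, h1⟩ := sum_mul_stdSimplex_mem_Icc m z ω a
  rw [Real.norm_of_nonneg (mul_nonneg hl h0)]
  exact mul_le_of_le_one_right hl h1

theorem summable_mixture {l : K → ℝ} (hl0 : ∀ k, 0 ≤ l k) (hl : HasSum l 1)
    (m : ∀ k, stdSimplex ℝ (D k)) (z : ∀ k, D k → Ω → stdSimplex ℝ I) (ω : Ω) (a : I) :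
    Summable fun k => l k * ∑ d, (m k).1 d * (z k d ω).1 a :=
  Summable.of_norm_bounded hl.summable fun k => norm_mul_sum_mul_stdSimplex_le (hl0 k) _ _ _ _

/-- The average of the distributions `z k d` with weights `l k * m k d`. -/
def mixture (l : K → ℝ) (hl0 : ∀ k, 0 ≤ l k) (hl : HasSum l 1) (m : ∀ k, stdSimplex ℝ (D k))
    (z : ∀ k, D k → Ω → stdSimplex ℝ I) (ω : Ω) : stdSimplex ℝ I :=
  ⟨fun a => ∑' k, l k * ∑ d, (m k).1 d * (z k d ω).1 a,
    fun a => tsum_nonneg fun k => mul_nonneg (hl0 k) (sum_mul_stdSimplex_mem_Icc _ _ _ _).1, by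
    rw [← Summable.tsum_finsetSum fun a _ => summable_mixture hl0 hl m z ω a]
    rw [← hl.tsum_eq]
    refine tsum_congr fun k => ?_
    rw [← Finset.mul_sum, Finset.sum_comm]
    simp_rw [← Finset.mul_sum, (z k _ ω).2.2, mul_one, (m k).2.2, mul_one]⟩

open Filter Topology in
/-- Given continuous maps `q k d` that preserve the faces of a product of simplices, every point
`y` of it is an average of the `q k d x`, for a suitable `x`, which for each `k` uses only those
`d` that maximize `U (q k d x)`. -/
theorem exists_optimal_mixture_eq [Fintype Ω] [Nonempty I] [∀ k, Nonempty (D k)] (l : K → ℝ)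
    (hl0 : ∀ k, 0 ≤ l k) (hl : HasSum l 1)
    (q : ∀ k, D k → (Ω → stdSimplex ℝ I) → (Ω → stdSimplex ℝ I))
    (hq : ∀ k d, Continuous (q k d))
    (hface : ∀ k d x ω a, (x ω).1 a = 0 → (q k d x ω).1 a = 0)
    {U : (Ω → stdSimplex ℝ I) → ℝ} (hU : Continuous U) (y : Ω → stdSimplex ℝ I) :
    ∃ (x : Ω → stdSimplex ℝ I) (m : ∀ k, stdSimplex ℝ (D k)),
      (∀ ω a, HasSum (fun k => l k * ∑ d, (m k).1 d * (q k d x ω).1 a) ((y ω).1 a)) ∧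
      ∀ k d, (m k).1 d ≠ 0 → ∀ d', U (q k d' x) ≤ U (q k d x) := by
  have hc : ∀ (ω : Ω) (a : I), Continuous fun x : Ω → stdSimplex ℝ I => (x ω).1 a := fun ω a =>
    (continuous_apply a).comp (continuous_subtype_val.comp (continuous_apply ω))
  have hcm : ∀ k d, Continuous fun m : ∀ k, stdSimplex ℝ (D k) => (m k).1 d := fun k d =>
    (continuous_apply d).comp (continuous_subtype_val.comp (continuous_apply k))
  have happrox : ∀ ε : ℝ, 0 < ε → ∃ (x : Ω → stdSimplex ℝ I) (m : ∀ k, stdSimplex ℝ (D k)),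
      mixture l hl0 hl m (fun k d => q k d x) = y ∧
      ∀ k d, (m k).1 d ≠ 0 → ∀ d', U (q k d' x) - ε < U (q k d x) := by
    intro ε hε
    let W : ∀ k, (Ω → stdSimplex ℝ I) → stdSimplex ℝ (D k) := fun k x =>
      nearOptimalWeights ε hε fun d => U (q k d x)
    have hW : ∀ k d, Continuous fun x => (W k x).1 d := fun k d =>
      (continuous_apply d).comp <| continuous_subtype_val.comp <|
        (continuous_nearOptimalWeights hε).comp (continuous_pi fun d => hU.comp (hq k d))
    obtain ⟨x, hx⟩ := surjective_of_preserves_faces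
      (F := fun x => mixture l hl0 hl (fun k => W k x) fun k d => q k d x) (by
        refine continuous_pi fun ω => Continuous.subtype_mk (continuous_pi fun a => ?_) _
        refine continuous_tsum (fun k => ?_) hl.summable fun k x =>
          norm_mul_sum_mul_stdSimplex_le (hl0 k) _ _ _ _
        exact continuous_const.mul (continuous_finsetSum _ fun d _ =>
          (hW k d).mul ((hc ω a).comp (hq k d)))) (by
        intro x ω a hxa
        change ∑' k, l k * ∑ d, (W k x).1 d * (q k d x ω).1 a = 0
        simp [hface _ _ x ω a hxa]) y
    exact ⟨x, fun k => W k x, hx, fun k d hd d' => lt_of_nearOptimalWeights_ne_zero hε hd d'⟩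
  choose x m hmix hopt using fun n : ℕ => happrox _ (Nat.one_div_pos_of_nat (n := n))
  let z : ℕ → (Ω → stdSimplex ℝ I) × (∀ k, stdSimplex ℝ (D k)) := fun n => (x n, m n)
  -- `K` may be infinite; compactness of the product gives a limit along an ultrafilter without
  -- extracting subsequences.
  let 𝓤 : Ultrafilter ℕ := hyperfilter ℕ
  obtain ⟨⟨x', m'⟩, hz⟩ : ∃ z', Tendsto z 𝓤 (𝓝 z') := ⟨_, (𝓤.map z).le_nhds_lim⟩
  have hx : Tendsto x 𝓤 (𝓝 x') := (continuous_fst.tendsto _).comp hz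
  have hm : Tendsto m 𝓤 (𝓝 m') := (continuous_snd.tendsto _).comp hz
  have hε : Tendsto (fun n : ℕ => 1 / ((n : ℝ) + 1)) 𝓤 (𝓝 0) :=
    tendsto_one_div_add_atTop_nhds_zero_nat.mono_left (Nat.hyperfilter_le_atTop)
  refine ⟨x', m', fun ω a => ?_, fun k d hd d' => ?_⟩
  · have hs := summable_mixture hl0 hl m' (fun k d => q k d x') ω a
    convert hs.hasSum using 1
    refine tendsto_nhds_unique (f := fun _ : ℕ => (y ω).1 a) (l := (𝓤 : Filter ℕ))
      tendsto_const_nhds ?_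
    have : ∀ n, (y ω).1 a = ∑' k, l k * ∑ d, (m n k).1 d * (q k d (x n) ω).1 a := fun n => by
      conv_lhs => rw [← hmix n]
      rfl
    refine Tendsto.congr (fun n => (this n).symm) ?_
    refine tendsto_tsum_of_dominated_convergence hl.summable (fun k => ?_)
      (Eventually.of_forall fun n k => norm_mul_sum_mul_stdSimplex_le (hl0 k) _ _ _ _)
    exact tendsto_const_nhds.mul (tendsto_finsetSum _ fun d _ =>
      (((hcm k d).tendsto _).comp hm).mul ((((hc ω a).comp (hq k d)).tendsto _).comp hx))
  -- A positive weight in the limit was positive before it, so the `ε`-optimality of `d` is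
  -- available there and passes to the limit.
  · have hne : ∀ᶠ n in (𝓤 : Filter ℕ), (m n k).1 d ≠ 0 :=
      (((hcm k d).tendsto _).comp hm).eventually_ne hd
    have h1 : Tendsto (fun n => U (q k d' (x n)) - 1 / ((n : ℝ) + 1)) 𝓤
        (𝓝 (U (q k d' x') - 0)) := (((hU.comp (hq k d')).tendsto _).comp hx).sub hε
    rw [sub_zero] at h1
    exact le_of_tendsto_of_tendsto h1 (((hU.comp (hq k d)).tendsto _).comp hx)
      (hne.mono fun n hn => (hopt n k d hn d').le)

end Mixture

/-! ### Selection laws and the sender's finitely many plans. -/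

section Plans

variable {Ω I : Type*}

section Law

variable [Fintype I]

/-- The distribution of the selected signal when `n` independent signals are drawn from `x`, and
`c` is the index that is selected as a function of them. -/
def selectionLaw {n : ℕ} (c : (Fin n → I) → Fin n) (x : stdSimplex ℝ I) : stdSimplex ℝ I := by
  classical
  exact ⟨fun a => ∑ t : Fin n → I, if t (c t) = a then ∏ i, x.1 (t i) else 0,
    fun a => Finset.sum_nonneg fun t _ => by
      split_ifs
      exacts [Finset.prod_nonneg fun i _ => x.2.1 _, le_rfl], by
    rw [Finset.sum_comm]
    simp_rw [Finset.sum_ite_eq, Finset.mem_univ, if_true]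
    rw [← Fintype.piFinset_univ, ← Finset.prod_univ_sum]
    simp [x.2.2]⟩

theorem sum_selectionLaw_mul {n : ℕ} (c : (Fin n → I) → Fin n) (x : stdSimplex ℝ I) (g : I → ℝ) :
    ∑ a, (selectionLaw c x).1 a * g a = ∑ t : Fin n → I, (∏ i, x.1 (t i)) * g (t (c t)) := by
  classical
  have : ∀ a, (selectionLaw c x).1 a * g a =
      ∑ t : Fin n → I, if t (c t) = a then (∏ i, x.1 (t i)) * g a else 0 := by
    intro a
    simp only [selectionLaw, Finset.sum_mul, ite_mul, zero_mul]
  simp_rw [this]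
  rw [Finset.sum_comm]
  simp

theorem ofReal_sum_selectionLaw_mul {n : ℕ} (c : (Fin n → I) → Fin n) (x : stdSimplex ℝ I)
    (g : I → ℝ≥0∞) :
    ∑ a, ENNReal.ofReal ((selectionLaw c x).1 a) * g a =
      ∑ t : Fin n → I, ENNReal.ofReal (∏ i, x.1 (t i)) * g (t (c t)) := by
  classical
  have : ∀ a, ENNReal.ofReal ((selectionLaw c x).1 a) * g a =
      ∑ t : Fin n → I, if t (c t) = a then ENNReal.ofReal (∏ i, x.1 (t i)) * g a else 0 := by
    intro a
    simp only [selectionLaw]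
    rw [ENNReal.ofReal_sum_of_nonneg, Finset.sum_mul]
    · refine Finset.sum_congr rfl fun t _ => ?_
      split_ifs <;> simp
    · intro t _
      split_ifs
      exacts [Finset.prod_nonneg fun i _ => x.2.1 _, le_rfl]
  simp_rw [this]
  rw [Finset.sum_comm]
  simp

theorem continuous_selectionLaw {n : ℕ} (c : (Fin n → I) → Fin n) :
    Continuous (selectionLaw c) := by
  refine Continuous.subtype_mk (continuous_pi fun a => continuous_finsetSum _ fun t _ => ?_) _
  split_ifs
  · exact continuous_finsetProd _ fun i _ =>
      (continuous_apply (t i)).comp continuous_subtype_val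
  · exact continuous_const

/-- A signal must be drawn in order to be selected. This face preservation is what makes the Brouwer
argument applicable. -/
theorem selectionLaw_eq_zero {n : ℕ} (c : (Fin n → I) → Fin n) {x : stdSimplex ℝ I} {a : I}
    (h : x.1 a = 0) : (selectionLaw c x).1 a = 0 := by
  refine Finset.sum_eq_zero fun t _ => ?_
  split_ifs with ht
  · exact Finset.prod_eq_zero (Finset.mem_univ (c t)) (by rw [ht, h])
  · rfl

end Law

/-- A way to select one of `n` signals. Either the selection depends on the signals only
(`none`), or the index `j` is given up (`some j`) and the selection from the remaining signals may
depend on the state. -/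
structure Plan (Ω I : Type*) (n : ℕ) where
  givenUp : Option (Fin n)
  select : Ω → (Fin n → I) → Fin n
  select_of_none : givenUp = none → ∀ ω ω', select ω = select ω'
  select_of_some : ∀ j, givenUp = some j → ∀ ω, (∀ t, select ω t ≠ j) ∧ DependsOn (select ω) {j}ᶜ

instance [Finite Ω] [Finite I] (n : ℕ) : Fintype (Plan Ω I n) :=
  haveI : Finite (Plan Ω I n) :=
    Finite.of_injective (fun p : Plan Ω I n => (p.givenUp, p.select)) fun p p' h => by
      cases p
      cases p'
      simpa using h
  Fintype.ofFinite _

/-- The plan that selects from all signals, without knowing the state. -/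
def Plan.blind {n : ℕ} (c : (Fin n → I) → Fin n) : Plan Ω I n :=
  ⟨none, fun _ => c, fun _ _ _ => rfl, nofun⟩

theorem Plan.nonempty {n : ℕ} (hn : 0 < n) : Nonempty (Plan Ω I n) :=
  ⟨Plan.blind fun _ => ⟨0, hn⟩⟩

/-- The plan that gives up the signal `j`, learns the state, and selects from the other signals one
that maximizes `w` in that state. -/
theorem Plan.exists_informed_max {n : ℕ} (hn : 1 < n) (j : Fin n) (w : I → Ω → ℝ) :
    ∃ p : Plan Ω I n, ∀ (ω : Ω) (t : Fin n → I) (i : Fin n), i ≠ j → w (t i) ω ≤ w (t (p.select ω t)) ω := by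
  classical
  have hne : (Finset.univ.erase j).Nonempty := by
    rw [← Finset.card_pos, Finset.card_erase_of_mem (Finset.mem_univ j), Finset.card_univ,
      Fintype.card_fin]
    omega
  -- Coordinate `j` is masked before the maximizer is chosen, so that even the tie-breaking ignores
  -- it.
  let v : Ω → (Fin n → I) → Fin n → ℝ := fun ω t i => if i = j then 0 else w (t i) ω
  have hex : ∀ h : Fin n → ℝ, ∃ i ∈ Finset.univ.erase j, ∀ i' ∈ Finset.univ.erase j, h i' ≤ h i :=
    fun h => Finset.exists_max_image _ _ hne
  choose sel hsel hmax using hex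
  refine ⟨⟨some j, fun ω t => sel (v ω t), nofun, fun j' hj' ω => ?_⟩,
    fun ω t i hi => ?_⟩
  · obtain rfl : j = j' := Option.some.inj hj'
    refine ⟨fun t => (Finset.mem_erase.1 (hsel _)).1, fun t t' htt' => ?_⟩
    have : v ω t = v ω t' := funext fun i => by
      by_cases hi : i = j
      · simp [v, hi]
      · simp [v, hi, htt' i hi]
    exact congrArg sel this
  · have h := hmax (v ω t) i (by simp [hi])
    have h' : sel (v ω t) ≠ j := (Finset.mem_erase.1 (hsel _)).1
    simpa only [v, hi, h', if_false] using h

end Plans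

/-! ### Finitely supported laws and their products. -/

section FiniteLaws

variable {I S : Type*} [Fintype I] [MeasurableSpace S]

/-- The law of `e a` when `a` is distributed according to `x`. -/
def discreteLaw (e : I → S) (x : stdSimplex ℝ I) : ProbabilityMeasure S :=
  ⟨∑ a, ENNReal.ofReal (x.1 a) • Measure.dirac (e a), ⟨by
    simp only [Measure.coe_finsetSum, Finset.sum_apply, Measure.smul_apply, smul_eq_mul,
      measure_univ, mul_one]
    rw [← ENNReal.ofReal_sum_of_nonneg fun a _ => x.2.1 a, x.2.2, ENNReal.ofReal_one]⟩⟩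

theorem coe_discreteLaw (e : I → S) (x : stdSimplex ℝ I) :
    (discreteLaw e x : Measure S) = ∑ a, ENNReal.ofReal (x.1 a) • Measure.dirac (e a) := rfl

/-- Lets a sure outcome be written with a fictitious draw from `x`, so that a slot with the
revealing experiment fits into `pi_discreteLaw`. -/
theorem discreteLaw_const (s : S) (x : stdSimplex ℝ I) :
    (discreteLaw (fun _ => s) x : Measure S) = Measure.dirac s := by
  rw [coe_discreteLaw, ← Finset.sum_smul, ← ENNReal.ofReal_sum_of_nonneg fun a _ => x.2.1 a,
    x.2.2, ENNReal.ofReal_one, one_smul]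

theorem pi_discreteLaw {ι : Type*} [Fintype ι] [DecidableEq ι] (e : ι → I → S) (x : stdSimplex ℝ I) :
    Measure.pi (fun i => (discreteLaw (e i) x : Measure S)) =
      ∑ t : ι → I, ENNReal.ofReal (∏ i, x.1 (t i)) • Measure.dirac fun i => e i (t i) := by
  refine (Measure.pi_eq fun s hs => ?_)
  simp only [coe_discreteLaw, Measure.coe_finsetSum, Finset.sum_apply, Measure.smul_apply,
    smul_eq_mul]
  rw [Finset.prod_univ_sum, Fintype.piFinset_univ]
  refine Finset.sum_congr rfl fun t _ => ?_
  rw [Finset.prod_mul_distrib, ENNReal.ofReal_prod_of_nonneg fun i _ => x.2.1 _]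
  congr 1
  rw [Measure.dirac_apply' _ (MeasurableSet.univ_pi hs)]
  simp_rw [Measure.dirac_apply' _ (hs _)]
  by_cases h : ∀ i, e i (t i) ∈ s i
  · rw [Set.indicator_of_mem (by simpa [Set.mem_pi] using h)]
    simp [h]
  · rw [Set.indicator_of_notMem (by simpa [Set.mem_pi] using h)]
    obtain ⟨i, hi⟩ := not_forall.1 h
    exact (Finset.prod_eq_zero (Finset.mem_univ i) (Set.indicator_of_notMem hi _)).symm

theorem map_sum_smul_dirac {α β : Type*} [MeasurableSpace α] [MeasurableSpace β] {T : Type*}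
    [Fintype T] (c : T → ℝ≥0∞) (y : T → α) {f : α → β} (hf : Measurable f) :
    (∑ t, c t • Measure.dirac (y t)).map f = ∑ t, c t • Measure.dirac (f (y t)) := by
  ext E hE
  rw [Measure.map_apply hf hE]
  simp only [Measure.coe_finsetSum, Finset.sum_apply, Measure.smul_apply,
    Measure.dirac_apply' _ hE, Measure.dirac_apply' _ (hf hE)]
  rfl

theorem integral_sum_smul_dirac {α : Type*} [MeasurableSpace α] {T : Type*}
    [Fintype T] (c : T → ℝ) (hc : ∀ t, 0 ≤ c t) (y : T → α) {f : α → ℝ} (hf : Measurable f) :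
    ∫ z, f z ∂(∑ t, ENNReal.ofReal (c t) • Measure.dirac (y t)) = ∑ t, c t * f (y t) := by
  rw [integral_finsetSum_measure]
  · refine Finset.sum_congr rfl fun t _ => ?_
    rw [integral_smul_measure, integral_dirac' _ _ hf.stronglyMeasurable,
      ENNReal.toReal_ofReal (hc t), smul_eq_mul]
  · intro t _
    refine Integrable.smul_measure ?_ ENNReal.ofReal_ne_top
    exact (integrable_const (f (y t))).congr (by
      rw [Filter.EventuallyEq, ae_dirac_iff (measurableSet_eq_fun measurable_const hf)])

theorem measurable_extend_of_finite {β γ : Type*} [MeasurableSpace β] [MeasurableSpace γ]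
    {f : I → β} (hf : Function.Injective f) (hm : ∀ a, MeasurableSet {f a}) (g : I → γ) (c : γ) :
    Measurable (Function.extend f g fun _ => c) := by
  let _ : MeasurableSpace I := ⊤
  have hemb : MeasurableEmbedding f := ⟨hf, measurable_from_top, fun {s} _ => by
    rw [← Set.biUnion_of_singleton s, Set.image_iUnion₂]
    exact MeasurableSet.biUnion (Set.to_countable s) fun a _ => by
      rw [Set.image_singleton]; exact hm a⟩
  exact hemb.measurable_extend measurable_from_top measurable_const

/-- The integral of a function of finitely many coordinates depends only on their laws. -/
theorem map_restrict_pi_congr {ι : Type*} [Fintype ι] (μ μ' : ι → Measure S)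
    [∀ i, IsProbabilityMeasure (μ i)] [∀ i, IsProbabilityMeasure (μ' i)] (J : Finset ι)
    (h : ∀ i ∈ J, μ i = μ' i) :
    (Measure.pi μ).map J.restrict = (Measure.pi μ').map J.restrict := by
  rw [← Measure.infinitePi_eq_pi, ← Measure.infinitePi_eq_pi, Measure.infinitePi_map_restrict,
    Measure.infinitePi_map_restrict]
  congr 1
  exact funext fun i => h i i.2

end FiniteLaws

/-! ### Single-outcome evidence and the receiver's response rule. -/

section EvidenceLemmas

variable {Ω S : Type*} [MeasurableSpace S] {ν : PMF ℕ+}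

/-- The evidence that consists of a single outcome of a single experiment. -/
def pointEvidence (ν : PMF ℕ+) (π : Experiment Ω S) (s : S) : Evidence Ω S ν :=
  ⟨{(π, s)}, by
    obtain ⟨k, hk⟩ := ν.support_nonempty
    exact ⟨k, hk, by rw [Multiset.card_singleton]; exact k.pos⟩⟩

theorem reveal_eq_pointEvidence_iff {k : ν.support} {π' : Fin k.1 → Experiment Ω S}
    {B : Finset (Fin k.1)} {s : Fin k.1 → S} {π : Experiment Ω S} {s₀ : S} :
    reveal k π' B s = pointEvidence ν π s₀ ↔ ∃ i, B = {i} ∧ π' i = π ∧ s i = s₀ := by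
  constructor
  · intro h
    have h' : B.val.map (fun i => (π' i, s i)) = {(π, s₀)} := congrArg Subtype.val h
    obtain ⟨i, hi, his⟩ := Multiset.map_eq_singleton.1 h'
    exact ⟨i, Finset.val_inj.1 hi, congrArg Prod.fst his, congrArg Prod.snd his⟩
  · rintro ⟨i, rfl, rfl, rfl⟩
    exact Subtype.ext (by simp [reveal, pointEvidence])

theorem pointEvidence_injective {π : Experiment Ω S} :
    Function.Injective (pointEvidence ν π) := by
  intro s s' h
  have h' : ({(π, s)} : Multiset (Experiment Ω S × S)) = {(π, s')} := congrArg Subtype.val h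
  exact congrArg Prod.snd (Multiset.singleton_inj.1 h')

/-- For fixed experiments and a fixed disclosed set, the preimage is empty or fixes one coordinate.
Response rules are then measurable, as they are constant off finitely many such points. -/
theorem measurableSet_singleton_pointEvidence [MeasurableSingletonClass S] (π : Experiment Ω S)
    (s₀ : S) : MeasurableSet {pointEvidence ν π s₀} := by
  refine MeasurableSpace.measurableSet_iInf.2 fun k => MeasurableSpace.measurableSet_iInf.2
    fun π' => MeasurableSpace.measurableSet_iInf.2 fun B => ?_
  rw [MeasurableSpace.map_def]
  have : reveal k π' B ⁻¹' {pointEvidence ν π s₀} =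
      ⋃ i, {s | B = {i} ∧ π' i = π ∧ s i = s₀} := by
    ext s
    simp [reveal_eq_pointEvidence_iff]
  rw [this]
  have h : ∀ i, MeasurableSet {s : Fin k.1 → S | s i = s₀} := fun i =>
    (measurableSet_singleton s₀).preimage (measurable_pi_apply i)
  exact MeasurableSet.iUnion fun i =>
    (MeasurableSet.const _).inter ((MeasurableSet.const _).inter (h i))

variable {I β : Type*}

/-- The rule for the receiver that responds with `r a` to the outcome `e a` of the experiment `π`,
and with `r₀` to all other evidence. -/
def responseRule (ν : PMF ℕ+) (π : Experiment Ω S) (e : I → S) (r : I → β) (r₀ : β) :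
    Evidence Ω S ν → β :=
  Function.extend (fun a => pointEvidence ν π (e a)) r fun _ => r₀

theorem responseRule_pointEvidence (π : Experiment Ω S) {e : I → S} (he : Function.Injective e)
    (r : I → β) (r₀ : β) (a : I) : responseRule ν π e r r₀ (pointEvidence ν π (e a)) = r a :=
  (pointEvidence_injective.comp he).extend_apply _ _ a

theorem responseRule_of_forall_ne {π : Experiment Ω S} {e : I → S}
    (r : I → β) (r₀ : β) {T : Evidence Ω S ν} (hT : ∀ a, pointEvidence ν π (e a) ≠ T) :
    responseRule ν π e r r₀ T = r₀ :=
  Function.extend_apply' _ _ _ fun ⟨a, ha⟩ => hT a ha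

theorem measurable_responseRule [MeasurableSingletonClass S] [Fintype I] [MeasurableSpace β]
    (π : Experiment Ω S) {e : I → S} (he : Function.Injective e) (r : I → β) (r₀ : β) :
    Measurable (responseRule ν π e r r₀) :=
  measurable_extend_of_finite (pointEvidence_injective.comp he)
    (fun _ => measurableSet_singleton_pointEvidence _ _) _ _

end EvidenceLemmas

/-! ### Plans as pure strategies. -/

section Strategies

variable {Ω I S : Type*} [Nonempty Ω] [Nonempty I]

/-- A left inverse of an embedding. -/
def decode (e : I ↪ S) : S → I := Function.extend e id fun _ => Classical.arbitrary I

theorem decode_apply (e : I ↪ S) (a : I) : decode e (e a) = a := e.injective.extend_apply _ _ a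

variable [MeasurableSpace S]

/-- The experiment whose outcome is `f ω` for sure in state `ω`. -/
def revealingExperiment (f : Ω → S) : Experiment Ω S :=
  fun ω => ⟨Measure.dirac (f ω), Measure.dirac.isProbabilityMeasure⟩

variable [Finite Ω] [Finite I] [MeasurableSingletonClass S]

theorem measurable_decode [MeasurableSpace I] (e : I ↪ S) : Measurable (decode e) :=
  have := Fintype.ofFinite I
  measurable_extend_of_finite e.injective (fun _ => measurableSet_singleton _) _ _

/-- The pure strategy that implements a plan: the signals are the outcomes of copies of `π`, the
experiment whose index is given up is `π'`, and only the selected outcome is disclosed. -/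
def Plan.strategy {n : ℕ} (p : Plan Ω I n) (π π' : Experiment Ω S) (e : I ↪ S) (f : Ω ↪ S) :
    PureStrategy Ω S n where
  experiment i := if p.givenUp = some i then π' else π
  disclosed s :=
    -- The arbitrary state is harmless: without a given-up slot the selection does not depend on the
    -- state.
    {p.select (p.givenUp.elim (Classical.arbitrary Ω) fun j => decode f (s j)) fun i => decode e (s i)}
  measurable_disclosed B := by
    let _ : MeasurableSpace Ω := ⊤
    let _ : MeasurableSpace I := ⊤
    let Φ : (Fin n → S) → Ω × (Fin n → I) := fun s =>
      (p.givenUp.elim (Classical.arbitrary Ω) fun j => decode f (s j), fun i => decode e (s i))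
    have hΦ : Measurable Φ := by
      refine Measurable.prodMk ?_ ?_
      · cases p.givenUp with
        | none => exact measurable_const
        | some j => exact (measurable_decode f).comp (measurable_pi_apply j)
      · exact measurable_pi_lambda _ fun i => (measurable_decode e).comp (measurable_pi_apply i)
    exact hΦ (MeasurableSet.of_discrete (s := {z | {p.select z.1 z.2} = B}))

/-- The outcome of the given-up slot reveals the state and is never disclosed, so the evidence is
distributed as if all slots had drawn from `x ω` and the plan had known `ω`. -/
theorem Plan.map_evidence_outcomeLaw [Fintype I] {ν : PMF ℕ+} {k : ν.support}
    (p : Plan Ω I k.1) (e : I ↪ S) (f : Ω ↪ S) (x : Ω → stdSimplex ℝ I) (π : Experiment Ω S)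
    (hπ : π = fun ω => discreteLaw e (x ω)) (ω : Ω) :
    ((p.strategy π (revealingExperiment f) e f).outcomeLaw ω).map
        (p.strategy π (revealingExperiment f) e f).evidence =
      ∑ a, ENNReal.ofReal ((selectionLaw (p.select ω) (x ω)).1 a) •
        Measure.dirac (pointEvidence ν π (e a)) := by
  classical
  set ψ := p.strategy π (revealingExperiment f) e f with hψ
  let E : Fin k.1 → I → S := fun i => if p.givenUp = some i then fun _ => f ω else e
  have hlaw : ψ.outcomeLaw ω =
      ∑ t : Fin k.1 → I, ENNReal.ofReal (∏ i, (x ω).1 (t i)) •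
        Measure.dirac fun i => E i (t i) := by
    rw [← pi_discreteLaw]
    refine congrArg Measure.pi (funext fun i => ?_)
    by_cases hi : p.givenUp = some i
    · simp only [hψ, Plan.strategy, E, hi, if_true, discreteLaw_const]
      rfl
    · simp only [hψ, Plan.strategy, E, hi, if_false, hπ]
  have hev : ∀ t : Fin k.1 → I, ψ.evidence (ν := ν) (fun i => E i (t i)) =
      pointEvidence ν π (e (t (p.select ω t))) := by
    intro t
    refine reveal_eq_pointEvidence_iff.2 ⟨p.select ω t, ?_⟩
    rcases hκ : p.givenUp with _ | j
    · refine ⟨?_, ?_, ?_⟩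
      · simp only [hψ, Plan.strategy, E, hκ, reduceCtorEq, if_false, decode_apply]
        rw [p.select_of_none hκ _ ω]
      · simp [hψ, Plan.strategy, hκ]
      · simp [E, hκ]
    · obtain ⟨hne, hdep⟩ := p.select_of_some j hκ ω
      have hne' : ∀ i : Fin k.1, i ≠ j → ¬ (some j = some i) := fun i hi h =>
        hi (Option.some.inj h).symm
      refine ⟨?_, ?_, ?_⟩
      · simp only [hψ, Plan.strategy, E, hκ, Option.elim_some, if_true, decode_apply]
        congr 1
        refine hdep fun i hi => ?_
        rw [if_neg (hne' i hi), decode_apply]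
      · simp only [hψ, Plan.strategy, hκ, if_neg (hne' _ (hne t))]
      · simp only [E, hκ, if_neg (hne' _ (hne t))]
  rw [hlaw, map_sum_smul_dirac _ _ ψ.measurable_evidence]
  simp_rw [hev]
  ext F hF
  simp only [Measure.coe_finsetSum, Finset.sum_apply, Measure.smul_apply, smul_eq_mul]
  exact (ofReal_sum_selectionLaw_mul (p.select ω) (x ω)
    fun a => Measure.dirac (pointEvidence ν π (e a)) F).symm

end Strategies

section Deviations

section MaxValue

variable {I S ι : Type*} [Fintype ι]

/-- The largest of `lo` and the values of the outcomes `z i`, where `w a` is the value of `e a` and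
all other outcomes have the value `lo`. -/
def maxValue (e : I ↪ S) (w : I → ℝ) (lo : ℝ) (z : ι → S) : ℝ :=
  (Finset.univ : Finset (Option ι)).sup' Finset.univ_nonempty
    fun o => o.elim lo fun i => Function.extend e w (fun _ => lo) (z i)

theorem measurable_maxValue [Fintype I] [MeasurableSpace S] [MeasurableSingletonClass S]
    (e : I ↪ S) (w : I → ℝ) (lo : ℝ) : Measurable (maxValue (ι := ι) e w lo) := by
  have hr : Measurable (Function.extend e w fun _ => lo) :=
    measurable_extend_of_finite e.injective (fun _ => measurableSet_singleton _) _ _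
  have := Finset.measurable_sup' (s := (Finset.univ : Finset (Option ι)))
    Finset.univ_nonempty
    (f := fun o (z : ι → S) => o.elim lo fun i => Function.extend e w (fun _ => lo) (z i))
    fun o _ => by
      cases o with
      | none => exact measurable_const
      | some i => exact hr.comp (measurable_pi_apply i)
  convert this using 1
  ext z
  rw [maxValue, Finset.sup'_apply]

theorem le_maxValue (e : I ↪ S) (w : I → ℝ) (lo : ℝ) (z : ι → S) : lo ≤ maxValue e w lo z :=
  Finset.le_sup' (s := (Finset.univ : Finset (Option ι)))
    (fun o => o.elim lo fun i => Function.extend e w (fun _ => lo) (z i)) (Finset.mem_univ none)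

theorem le_maxValue_of_eq (e : I ↪ S) (w : I → ℝ) (lo : ℝ) {z : ι → S} {i : ι} {a : I}
    (h : z i = e a) : w a ≤ maxValue e w lo z := by
  have := Finset.le_sup' (s := (Finset.univ : Finset (Option ι)))
    (fun o => o.elim lo fun i => Function.extend e w (fun _ => lo) (z i))
    (Finset.mem_univ (some i))
  simp only [Option.elim_some, h, e.injective.extend_apply] at this
  exact this

theorem maxValue_le (e : I ↪ S) (w : I → ℝ) {lo C : ℝ} {z : ι → S}
    (hlo : lo ≤ C) (hw : ∀ i a, z i = e a → w a ≤ C) : maxValue e w lo z ≤ C := by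
  refine Finset.sup'_le _ _ fun o _ => ?_
  cases o with
  | none => exact hlo
  | some i =>
    by_cases h : ∃ a, e a = z i
    · obtain ⟨a, ha⟩ := h
      simp only [Option.elim_some, ← ha, e.injective.extend_apply]
      exact hw i a ha.symm
    · simpa only [Option.elim_some, Function.extend_apply' _ _ _ h] using hlo

end MaxValue

section Utility

variable {Ω A : Type*} [Fintype A]

theorem abs_mixedUtility_le (w : A → Ω → ℝ) (x : stdSimplex ℝ A) (ω : Ω) :
    |mixedUtility w x ω| ≤ ∑ a, |w a ω| := by
  refine (Finset.abs_sum_le_sum_abs _ _).trans (Finset.sum_le_sum fun a _ => ?_)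
  rw [abs_mul, abs_of_nonneg (x.2.1 a)]
  exact mul_le_of_le_one_left (abs_nonneg _) (stdSimplex_apply_le_one x a)

theorem measurable_mixedUtility (w : A → Ω → ℝ) (ω : Ω) :
    Measurable fun x : stdSimplex ℝ A => mixedUtility w x ω := by
  refine Continuous.measurable (continuous_finsetSum _ fun a _ => ?_)
  exact ((continuous_apply a).comp continuous_subtype_val).mul continuous_const

end Utility

variable {Ω A I S : Type*} [Fintype Ω] [Fintype A] [MeasurableSpace S]

instance {k : ℕ} (ψ : PureStrategy Ω S k) (ω : Ω) : IsProbabilityMeasure (ψ.outcomeLaw ω) := by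
  unfold PureStrategy.outcomeLaw
  infer_instance

theorem abs_purePayoff_le (G : Game Ω A) (R : Assessment Ω A S G.ν) {k : G.ν.support}
    (ψ : PureStrategy Ω S k.1) :
    |purePayoff G R ψ| ≤ ∑ ω, G.prior.1 ω * ∑ a, |G.v a ω| := by
  refine (Finset.abs_sum_le_sum_abs _ _).trans (Finset.sum_le_sum fun ω _ => ?_)
  rw [abs_mul, abs_of_nonneg (G.prior.2.1 ω)]
  refine mul_le_mul_of_nonneg_left ?_ (G.prior.2.1 ω)
  have := norm_integral_le_of_norm_le_const (μ := ψ.outcomeLaw ω)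
    (f := fun s => mixedUtility G.v (R.σ (ψ.evidence s)) ω)
    (Filter.Eventually.of_forall fun s => abs_mixedUtility_le G.v (R.σ (ψ.evidence s)) ω)
  simpa using this

theorem measurable_mixedUtility_evidence (G : Game Ω A) (R : Assessment Ω A S G.ν)
    {k : G.ν.support} (ψ : PureStrategy Ω S k.1) (ω : Ω) :
    Measurable fun s => mixedUtility G.v (R.σ (ψ.evidence s)) ω :=
  (measurable_mixedUtility G.v ω).comp (R.measurable_σ.comp ψ.measurable_evidence)

/-- Against a receiver who punishes everything except single outcomes of the experiment `π`, the
sender has nothing better than the plans. -/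
theorem purePayoff_le_of_plan_le [Fintype I] [MeasurableSingletonClass S] (G : Game Ω A)
    (R : Assessment Ω A S G.ν) (e : I ↪ S)
    (x : Ω → stdSimplex ℝ I) (π : Experiment Ω S) (hπ : π = fun ω => discreteLaw e (x ω))
    (act : I → stdSimplex ℝ A) (pun : stdSimplex ℝ A)
    (hσ : R.σ = responseRule G.ν π e act pun)
    (hpun : ∀ a ω, mixedUtility G.v pun ω ≤ mixedUtility G.v (act a) ω)
    {k : G.ν.support} (ψ : PureStrategy Ω S k.1) {V : ℝ}
    (hV : ∀ p : Plan Ω I k.1, ∑ ω, G.prior.1 ω *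
      ∑ a, (selectionLaw (p.select ω) (x ω)).1 a * mixedUtility G.v (act a) ω ≤ V) :
    purePayoff G R ψ ≤ V := by
  classical
  have hcases : ∀ s, (∃ i a, ψ.disclosed s = {i} ∧ ψ.experiment i = π ∧ s i = e a ∧
      R.σ (ψ.evidence s) = act a) ∨ R.σ (ψ.evidence s) = pun := by
    intro s
    rw [hσ]
    by_cases h : ∃ a, pointEvidence G.ν π (e a) = ψ.evidence s
    · obtain ⟨a, ha⟩ := h
      obtain ⟨i, hB, hi, hs⟩ := reveal_eq_pointEvidence_iff.1 ha.symm
      exact Or.inl ⟨i, a, hB, hi, hs, by rw [← ha, responseRule_pointEvidence _ e.injective]⟩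
    · exact Or.inr (responseRule_of_forall_ne _ _ fun a ha => h ⟨a, ha⟩)
  have hk : 0 < (k.1 : ℕ) := k.1.pos
  have hlaw : ∀ ω, Measure.pi (fun _ : Fin k.1 => (π ω : Measure S)) =
      ∑ t : Fin k.1 → I, ENNReal.ofReal (∏ i, (x ω).1 (t i)) •
        Measure.dirac fun i => e (t i) := fun ω => by
    rw [hπ]; exact pi_discreteLaw (fun _ => e) (x ω)
  have hprod : ∀ ω (t : Fin k.1 → I), 0 ≤ ∏ i, (x ω).1 (t i) := fun ω t =>
    Finset.prod_nonneg fun i _ => (x ω).2.1 _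
  suffices h : ∃ p : Plan Ω I k.1, ∀ ω,
      ∫ s, mixedUtility G.v (R.σ (ψ.evidence s)) ω ∂(ψ.outcomeLaw ω) ≤
        ∑ t : Fin k.1 → I, (∏ i, (x ω).1 (t i)) *
          mixedUtility G.v (act (t (p.select ω t))) ω by
    obtain ⟨p, hp⟩ := h
    refine le_trans (Finset.sum_le_sum fun ω _ => ?_) (hV p)
    rw [sum_selectionLaw_mul]
    exact mul_le_mul_of_nonneg_left (hp ω) (G.prior.2.1 ω)
  by_cases hall : ∀ i, ψ.experiment i = π
  · let c : (Fin k.1 → I) → Fin k.1 := fun t =>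
      if h : ∃ i, ψ.disclosed (fun i => e (t i)) = {i} then h.choose else ⟨0, hk⟩
    refine ⟨Plan.blind c, fun ω => ?_⟩
    have : ψ.outcomeLaw ω = Measure.pi (fun _ : Fin k.1 => (π ω : Measure S)) := by
      simp only [PureStrategy.outcomeLaw, hall]
    rw [this, hlaw, integral_sum_smul_dirac _ (hprod ω) _
      (measurable_mixedUtility_evidence G R ψ ω)]
    refine Finset.sum_le_sum fun t _ => mul_le_mul_of_nonneg_left ?_ (hprod ω t)
    rcases hcases (fun i => e (t i)) with ⟨i, a, hB, -, hs, hact⟩ | h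
    · have hc : c t = i := by
        have hex : ∃ i, ψ.disclosed (fun i => e (t i)) = {i} := ⟨i, hB⟩
        have h1 : c t = hex.choose := dif_pos hex
        rw [h1]
        exact (Finset.singleton_injective (hB.symm.trans hex.choose_spec)).symm
      rw [hact, ← e.injective hs, ← hc]
      exact le_rfl
    · rw [h]
      exact hpun _ ω
  · obtain ⟨j, hj⟩ := not_forall.1 hall
    let J : Finset (Fin k.1) := Finset.univ.filter fun i => ψ.experiment i = π
    have hJ : ∀ i, i ∈ J ↔ ψ.experiment i = π := fun i => by simp [J]
    obtain ⟨p, hp⟩ : ∃ p : Plan Ω I k.1, ∀ (ω : Ω) (t : Fin k.1 → I), ∀ i ∈ J,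
        mixedUtility G.v (act (t i)) ω ≤ mixedUtility G.v (act (t (p.select ω t))) ω := by
      rcases Nat.lt_or_ge 1 (k.1 : ℕ) with h1 | h1
      · obtain ⟨p, hp⟩ := Plan.exists_informed_max h1 j
          fun (a : I) ω => mixedUtility G.v (act a) ω
        refine ⟨p, fun ω t i hi => hp ω t i ?_⟩
        rintro rfl
        exact hj ((hJ i).1 hi)
      · refine ⟨Plan.blind fun _ => ⟨0, hk⟩, fun ω t i hi => absurd ((hJ i).1 hi) ?_⟩
        have : i = j := Fin.ext (by omega)
        rwa [this]
    refine ⟨p, fun ω => ?_⟩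
    set C := ∑ a, |G.v a ω|
    let w : I → ℝ := fun a => mixedUtility G.v (act a) ω
    let lo : ℝ := mixedUtility G.v pun ω
    have hwC : ∀ a, w a ≤ C := fun a => (abs_le.1 (abs_mixedUtility_le G.v (act a) ω)).2
    obtain ⟨hloC, hloC'⟩ := abs_le.1 (abs_mixedUtility_le G.v pun ω)
    have hm : Measurable (maxValue (ι := J) e w lo) := measurable_maxValue e w lo
    have hres : Measurable (J.restrict (π := fun _ => S)) := Finset.measurable_restrict J
    have hle : ∀ s, mixedUtility G.v (R.σ (ψ.evidence s)) ω ≤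
        maxValue e w lo (J.restrict s) := by
      intro s
      rcases hcases s with ⟨i, a, -, hi, hs, hact⟩ | h
      · rw [hact]
        exact le_maxValue_of_eq e w lo (z := J.restrict s) (i := ⟨i, (hJ i).2 hi⟩) hs
      · rw [h]
        exact le_maxValue e w lo _
    calc ∫ s, mixedUtility G.v (R.σ (ψ.evidence s)) ω ∂(ψ.outcomeLaw ω)
        ≤ ∫ s, maxValue e w lo (J.restrict s) ∂(ψ.outcomeLaw ω) := by
          refine integral_mono ?_ ?_ hle
          · exact Integrable.of_bound
              (measurable_mixedUtility_evidence G R ψ ω).aestronglyMeasurable C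
              (Filter.Eventually.of_forall fun s => abs_mixedUtility_le _ _ _)
          · refine Integrable.of_bound (hm.comp hres).aestronglyMeasurable C
              (Filter.Eventually.of_forall fun s => abs_le.2 ⟨?_, ?_⟩)
            · exact hloC.trans (le_maxValue _ _ _ _)
            · exact maxValue_le e w hloC' fun i a _ => hwC a
      _ = ∫ z, maxValue e w lo z ∂((ψ.outcomeLaw ω).map J.restrict) :=
          (integral_map hres.aemeasurable hm.aestronglyMeasurable).symm
      _ = ∫ z, maxValue e w lo z
            ∂((Measure.pi fun _ : Fin k.1 => (π ω : Measure S)).map J.restrict) := by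
          congr 1
          exact map_restrict_pi_congr _ _ J fun i hi => by rw [(hJ i).1 hi]
      _ = ∫ s, maxValue e w lo (J.restrict s)
            ∂(Measure.pi fun _ : Fin k.1 => (π ω : Measure S)) :=
          integral_map hres.aemeasurable hm.aestronglyMeasurable
      _ = ∑ t : Fin k.1 → I, (∏ i, (x ω).1 (t i)) *
            maxValue e w lo (J.restrict fun i => e (t i)) := by
          rw [hlaw]
          exact integral_sum_smul_dirac _ (hprod ω) _ (hm.comp hres)
      _ ≤ _ := by
          refine Finset.sum_le_sum fun t _ => mul_le_mul_of_nonneg_left ?_ (hprod ω t)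
          refine maxValue_le e w (hpun _ ω) fun i a hi => ?_
          have : t i = a := e.injective hi
          rw [← this]
          exact hp ω t i i.2

end Deviations

section PMF

theorem hasSum_toReal_pmf {α : Type*} (μ : PMF α) : HasSum (fun a => (μ a).toReal) 1 := by
  have h := ENNReal.hasSum_toReal (f := μ) (by rw [μ.tsum_coe]; exact ENNReal.one_ne_top)
  rwa [← ENNReal.tsum_toReal_eq fun a => μ.apply_ne_top a, μ.tsum_coe, ENNReal.toReal_one] at h

theorem hasSum_toReal_pmf_support {α : Type*} (μ : PMF α) :
    HasSum (fun a : μ.support => (μ a.1).toReal) 1 := by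
  refine (hasSum_subtype_iff_of_support_subset (f := fun a => (μ a).toReal) ?_).2
    (hasSum_toReal_pmf μ)
  intro a ha h
  exact ha (by simp [h])

theorem tsum_map_mul {α β : Type*} (μ : PMF α) (f : α → β) (g : β → ℝ≥0∞) :
    ∑' b, μ.map f b * g b = ∑' a, μ a * g (f a) := by
  classical
  simp_rw [PMF.map_apply, ← ENNReal.tsum_mul_right]
  rw [ENNReal.tsum_comm]
  refine tsum_congr fun a => ?_
  rw [tsum_eq_single (f a)]
  · simp
  · intro b hb
    simp [hb]

theorem tsum_map_toReal_mul {α β : Type*} [Fintype α] (μ : PMF α) (f : α → β) (g : β → ℝ) :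
    ∑' b, (μ.map f b).toReal * g b = ∑ a, (μ a).toReal * g (f a) := by
  classical
  refine HasSum.tsum_eq ?_
  have : ∀ b, (μ.map f b).toReal * g b =
      ∑ a, if b = f a then (μ a).toReal * g (f a) else 0 := by
    intro b
    rw [PMF.map_apply, tsum_fintype, ENNReal.toReal_sum, Finset.sum_mul]
    · refine Finset.sum_congr rfl fun a _ => ?_
      split_ifs with h
      · rw [h]
      · simp
    · intro a _
      split_ifs
      exacts [μ.apply_ne_top a, ENNReal.zero_ne_top]
  simp_rw [this]
  exact hasSum_sum fun a _ => hasSum_ite_eq (f a) _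

/-- A point of the simplex as a probability mass function. -/
def simplexPMF {D : Type*} [Fintype D] (m : stdSimplex ℝ D) : PMF D :=
  PMF.ofFintype (fun d => ENNReal.ofReal (m.1 d)) (by
    rw [← ENNReal.ofReal_sum_of_nonneg fun d _ => m.2.1 d, m.2.2, ENNReal.ofReal_one])

theorem simplexPMF_apply {D : Type*} [Fintype D] (m : stdSimplex ℝ D) (d : D) :
    simplexPMF m d = ENNReal.ofReal (m.1 d) := rfl

end PMF

section EvidenceLaw

variable {Ω A I S : Type*} [Fintype Ω] [Nonempty Ω] [Fintype I] [Nonempty I] [MeasurableSpace S]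
  [MeasurableSingletonClass S]

theorem jointLaw_eq_sum_dirac (G : Game Ω A) (e : I ↪ S) (f : Ω ↪ S) (x y : Ω → stdSimplex ℝ I)
    (π : Experiment Ω S) (hπ : π = fun ω => discreteLaw e (x ω))
    (m : ∀ k : G.ν.support, stdSimplex ℝ (Plan Ω I k.1))
    (hy : ∀ ω a, HasSum (fun k : G.ν.support => (G.ν k.1).toReal *
      ∑ p : Plan Ω I k.1, (m k).1 p * (selectionLaw (p.select ω) (x ω)).1 a) ((y ω).1 a)) (ω : Ω) :
    jointLaw G (fun k => (simplexPMF (m k)).map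
        fun p => p.strategy π (revealingExperiment f) e f) ω =
      ∑ a, ENNReal.ofReal (G.prior.1 ω * (y ω).1 a) •
        Measure.dirac (pointEvidence G.ν π (e a)) := by
  ext E hE
  have hterm : ∀ k : G.ν.support, ∀ a, 0 ≤ (G.ν k.1).toReal *
      ∑ p : Plan Ω I k.1, (m k).1 p * (selectionLaw (p.select ω) (x ω)).1 a := fun k a =>
    mul_nonneg ENNReal.toReal_nonneg (Finset.sum_nonneg fun p _ =>
      mul_nonneg ((m k).2.1 p) ((selectionLaw (p.select ω) (x ω)).2.1 a))
  simp only [jointLaw, Measure.smul_apply, smul_eq_mul, Measure.sum_apply _ hE,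
    Measure.coe_finsetSum, Finset.sum_apply]
  have h1 : ∀ k : G.ν.support,
      (∑' ψ, ((simplexPMF (m k)).map fun p => p.strategy π (revealingExperiment f) e f) ψ *
        (ψ.outcomeLaw ω).map (ψ.evidence (ν := G.ν)) E) =
      ∑ p : Plan Ω I k.1, ENNReal.ofReal ((m k).1 p) *
        ∑ a, ENNReal.ofReal ((selectionLaw (p.select ω) (x ω)).1 a) *
          Measure.dirac (pointEvidence G.ν π (e a)) E := by
    intro k
    rw [tsum_map_mul _ _ fun ψ : PureStrategy Ω S k.1 =>
      (ψ.outcomeLaw ω).map (ψ.evidence (ν := G.ν)) E, tsum_fintype]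
    refine Finset.sum_congr rfl fun p _ => ?_
    rw [simplexPMF_apply, p.map_evidence_outcomeLaw e f x π hπ ω]
    simp only [Measure.smul_apply, smul_eq_mul, Measure.coe_finsetSum, Finset.sum_apply]
  have h2 : ∀ k : G.ν.support, G.ν k.1 * (∑ p : Plan Ω I k.1, ENNReal.ofReal ((m k).1 p) *
        ∑ a, ENNReal.ofReal ((selectionLaw (p.select ω) (x ω)).1 a) *
          Measure.dirac (pointEvidence G.ν π (e a)) E) =
      ∑ a, ENNReal.ofReal ((G.ν k.1).toReal *
        ∑ p : Plan Ω I k.1, (m k).1 p * (selectionLaw (p.select ω) (x ω)).1 a) *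
          Measure.dirac (pointEvidence G.ν π (e a)) E := by
    intro k
    simp_rw [Finset.mul_sum]
    rw [Finset.sum_comm]
    refine Finset.sum_congr rfl fun a _ => ?_
    rw [ENNReal.ofReal_sum_of_nonneg fun p _ => mul_nonneg ENNReal.toReal_nonneg
      (mul_nonneg ((m k).2.1 p) ((selectionLaw (p.select ω) (x ω)).2.1 a)), Finset.sum_mul]
    refine Finset.sum_congr rfl fun p _ => ?_
    rw [ENNReal.ofReal_mul ENNReal.toReal_nonneg, ENNReal.ofReal_mul ((m k).2.1 p),
      ENNReal.ofReal_toReal (G.ν.apply_ne_top _)]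
    ring
  simp_rw [h1, h2]
  rw [Summable.tsum_finsetSum fun a _ => ENNReal.summable, Finset.mul_sum]
  refine Finset.sum_congr rfl fun a _ => ?_
  rw [ENNReal.tsum_mul_right, ← ENNReal.ofReal_tsum_of_nonneg (fun k => hterm k a)
    (hy ω a).summable, (hy ω a).tsum_eq, ENNReal.ofReal_mul (G.prior.2.1 ω), mul_assoc]

end EvidenceLaw

section Equilibrium

variable {Ω A I S : Type*} [Fintype Ω] [Fintype A] [MeasurableSpace S]

theorem typePayoff_le (G : Game Ω A) (R : Assessment Ω A S G.ν) {k : G.ν.support}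
    (m : PMF (PureStrategy Ω S k.1)) {V : ℝ}
    (hV : ∀ ψ : PureStrategy Ω S k.1, purePayoff G R ψ ≤ V) : typePayoff G R m ≤ V := by
  have hm := hasSum_toReal_pmf m
  have h1 := hm.mul_right V
  rw [one_mul] at h1
  rw [← h1.tsum_eq]
  refine Summable.tsum_le_tsum (fun ψ => mul_le_mul_of_nonneg_left (hV ψ) ENNReal.toReal_nonneg)
    ?_ h1.summable
  refine Summable.of_norm_bounded 
    (hm.summable.mul_right (∑ ω, G.prior.1 ω * ∑ a, |G.v a ω|)) fun ψ => ?_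
  rw [norm_mul, Real.norm_of_nonneg ENNReal.toReal_nonneg]
  exact mul_le_mul_of_nonneg_left (abs_purePayoff_le G R ψ) ENNReal.toReal_nonneg

variable [Nonempty Ω] [Fintype I] [Nonempty I] [MeasurableSingletonClass S]

theorem Plan.purePayoff_strategy (G : Game Ω A) (R : Assessment Ω A S G.ν) (e : I ↪ S)
    (f : Ω ↪ S) (x : Ω → stdSimplex ℝ I) (π : Experiment Ω S)
    (hπ : π = fun ω => discreteLaw e (x ω)) (act : I → stdSimplex ℝ A) (pun : stdSimplex ℝ A)
    (hσ : R.σ = responseRule G.ν π e act pun) {k : G.ν.support} (p : Plan Ω I k.1) :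
    purePayoff G R (p.strategy π (revealingExperiment f) e f) =
      ∑ ω, G.prior.1 ω * ∑ a, (selectionLaw (p.select ω) (x ω)).1 a *
        mixedUtility G.v (act a) ω := by
  refine Finset.sum_congr rfl fun ω _ => ?_
  congr 1
  have hm : Measurable fun T => mixedUtility G.v (R.σ T) ω :=
    (measurable_mixedUtility G.v ω).comp R.measurable_σ
  rw [← integral_map (f := fun T => mixedUtility G.v (R.σ T) ω)
    (PureStrategy.measurable_evidence _).aemeasurable hm.aestronglyMeasurable,
    p.map_evidence_outcomeLaw e f x π hπ ω,
    integral_sum_smul_dirac _ (fun a => (selectionLaw (p.select ω) (x ω)).2.1 a) _ hm]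
  simp_rw [hσ, responseRule_pointEvidence _ e.injective]

/-- If the receiver follows the beliefs `bel a` and replies `act a` after the signal `a`, and
punishes all other evidence, then any joint distribution of signals and states that is consistent
with these beliefs arises in an equilibrium. -/
theorem exists_equilibrium_of_punishment (G : Game Ω A) (e : I ↪ S) (f : Ω ↪ S)
    (y : Ω → stdSimplex ℝ I) (bel : I → stdSimplex ℝ Ω) (act : I → stdSimplex ℝ A)
    (q : stdSimplex ℝ Ω) (pun : stdSimplex ℝ A)
    (hbel : ∀ a ω, (∑ ω', G.prior.1 ω' * (y ω').1 a) * (bel a).1 ω = G.prior.1 ω * (y ω).1 a)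
    (hact : ∀ a, IsBestReply G.u (bel a) (act a)) (hq : IsBestReply G.u q pun)
    (hpun : ∀ a ω, mixedUtility G.v pun ω ≤ mixedUtility G.v (act a) ω) :
    ∃ (τ : SenderStrategy Ω S G.ν) (R : Assessment Ω A S G.ν), IsWPBE G τ R ∧
      senderPayoff G R τ = ∑ ω, ∑ a, G.prior.1 ω * (y ω).1 a * mixedUtility G.v (act a) ω ∧
      (∀ T, IsBestReply G.u (R.ρ T) (R.σ T)) ∧
      ∃ π π' : Experiment Ω S, π'.IsFullyRevealing ∧
        ∀ k : G.ν.support, ∀ ψ ∈ (τ k).support,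
          (∀ i, ψ.experiment i = π) ∨
          (1 < (k.1 : ℕ) ∧ ∃ j, ψ.experiment j = π' ∧ ∀ i, i ≠ j → ψ.experiment i = π) := by
  have : ∀ k : G.ν.support, Nonempty (Plan Ω I k.1) := fun k => Plan.nonempty k.1.pos
  let U : (Ω → stdSimplex ℝ I) → ℝ := fun z =>
    ∑ ω, G.prior.1 ω * ∑ a, (z ω).1 a * mixedUtility G.v (act a) ω
  have hU : Continuous U := continuous_finsetSum _ fun ω _ => continuous_const.mul
    (continuous_finsetSum _ fun a _ => Continuous.mul ((continuous_apply a).comp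
      (continuous_subtype_val.comp (continuous_apply ω))) continuous_const)
  obtain ⟨x, m, hxy, hopt⟩ := exists_optimal_mixture_eq
    (fun k : G.ν.support => (G.ν k.1).toReal) (fun k => ENNReal.toReal_nonneg)
    (hasSum_toReal_pmf_support G.ν)
    (fun k (p : Plan Ω I k.1) x ω => selectionLaw (p.select ω) (x ω))
    (fun k p => continuous_pi fun ω =>
      (continuous_selectionLaw (p.select ω)).comp (continuous_apply ω))
    (fun k p x ω a h => selectionLaw_eq_zero _ h) hU y
  let π : Experiment Ω S := fun ω => discreteLaw e (x ω)
  let strat : ∀ k : G.ν.support, Plan Ω I k.1 → PureStrategy Ω S k.1 := fun k p =>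
    p.strategy π (revealingExperiment f) e f
  let τ : SenderStrategy Ω S G.ν := fun k => (simplexPMF (m k)).map (strat k)
  let R : Assessment Ω A S G.ν :=
    { ρ := responseRule G.ν π e bel q
      σ := responseRule G.ν π e act pun
      measurable_ρ := measurable_responseRule π e.injective bel q
      measurable_σ := measurable_responseRule π e.injective act pun }
  have hbest : ∀ T, IsBestReply G.u (R.ρ T) (R.σ T) := by
    intro T
    by_cases h : ∃ a, pointEvidence G.ν π (e a) = T
    · obtain ⟨a, rfl⟩ := h
      simp only [R, responseRule_pointEvidence _ e.injective]
      exact hact a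
    · have h' : ∀ a, pointEvidence G.ν π (e a) ≠ T := fun a ha => h ⟨a, ha⟩
      simp only [R, responseRule_of_forall_ne _ _ h']
      exact hq
  have hpay : ∀ (k : G.ν.support) (p : Plan Ω I k.1), purePayoff G R (strat k p) =
      U fun ω => selectionLaw (p.select ω) (x ω) := fun k p =>
    p.purePayoff_strategy G R e f x π rfl act pun rfl
  have htype : ∀ k, typePayoff G R (τ k) =
      ∑ p, (m k).1 p * U fun ω => selectionLaw (p.select ω) (x ω) := by
    intro k
    refine (tsum_map_toReal_mul _ _ _).trans (Finset.sum_congr rfl fun p _ => ?_)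
    rw [simplexPMF_apply, ENNReal.toReal_ofReal ((m k).2.1 p), hpay]
  have hjoint := jointLaw_eq_sum_dirac G e f x y π rfl m hxy
  refine ⟨τ, R, ⟨fun k m' => ?_, fun ω E hE => ?_, Filter.Eventually.of_forall hbest⟩, ?_, hbest,
    π, revealingExperiment f, ⟨f, fun _ => rfl⟩, fun k ψ hψ => ?_⟩
  · obtain ⟨p₀, hp₀⟩ : ∃ p, (m k).1 p ≠ 0 := by
      by_contra! h
      have := (m k).2.2
      simp [h] at this
    have hval : typePayoff G R (τ k) = U fun ω => selectionLaw (p₀.select ω) (x ω) := by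
      rw [htype, ← one_mul (U _), ← (m k).2.2, Finset.sum_mul]
      refine Finset.sum_congr rfl fun p _ => ?_
      by_cases hp : (m k).1 p = 0
      · rw [hp, zero_mul, zero_mul]
      · rw [le_antisymm (hopt k p₀ hp₀ p) (hopt k p hp p₀)]
    rw [hval]
    exact typePayoff_le G R m' fun ψ =>
      purePayoff_le_of_plan_le G R e x π rfl act pun rfl hpun ψ fun p => hopt k p₀ hp₀ p
  · have hF : Measurable (E.indicator fun T => ENNReal.ofReal ((R.ρ T).1 ω)) := by
      refine Measurable.indicator ?_ hE
      exact ((measurable_pi_apply ω).comp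
        (measurable_subtype_coe.comp R.measurable_ρ)).ennreal_ofReal
    have h1 : ∀ a, R.ρ (pointEvidence G.ν π (e a)) = bel a := fun a =>
      responseRule_pointEvidence π e.injective bel q a
    rw [← lintegral_indicator hE, evidenceLaw, lintegral_finsetSum_measure]
    simp_rw [τ, strat, hjoint, lintegral_finsetSum_measure, lintegral_smul_measure,
      lintegral_dirac' _ hF]
    rw [Finset.sum_comm]
    simp only [Measure.smul_apply, smul_eq_mul, Measure.coe_finsetSum, Finset.sum_apply]
    refine Finset.sum_congr rfl fun a _ => ?_
    rw [← Finset.sum_mul, ← ENNReal.ofReal_sum_of_nonneg fun ω' _ =>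
      mul_nonneg (G.prior.2.1 ω') ((y ω').2.1 a), Measure.dirac_apply' _ hE]
    by_cases ha : pointEvidence G.ν π (e a) ∈ E
    · rw [Set.indicator_of_mem ha, Set.indicator_of_mem ha, h1, Pi.one_apply, mul_one,
        ← ENNReal.ofReal_mul, hbel]
      exact Finset.sum_nonneg fun ω' _ => mul_nonneg (G.prior.2.1 ω') ((y ω').2.1 a)
    · rw [Set.indicator_of_notMem ha, Set.indicator_of_notMem ha, mul_zero, mul_zero]
  · refine HasSum.tsum_eq ?_
    have h1 : ∀ k : G.ν.support, (G.ν k.1).toReal * typePayoff G R (τ k) =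
        ∑ ω, ∑ a, G.prior.1 ω * ((G.ν k.1).toReal *
          ∑ p, (m k).1 p * (selectionLaw (p.select ω) (x ω)).1 a) * mixedUtility G.v (act a) ω := by
      intro k
      rw [htype]
      simp only [U, Finset.mul_sum, Finset.sum_mul]
      rw [Finset.sum_comm]
      refine Finset.sum_congr rfl fun ω _ => ?_
      rw [Finset.sum_comm]
      refine Finset.sum_congr rfl fun a _ => Finset.sum_congr rfl fun p _ => ?_
      ring
    simp_rw [h1]
    exact hasSum_sum fun ω _ => hasSum_sum fun a _ => ((hxy ω a).mul_left _).mul_right _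
  · obtain ⟨p, -, rfl⟩ := (PMF.mem_support_map_iff _ _ _).1 hψ
    rcases hκ : p.givenUp with _ | j
    · exact Or.inl fun i => by simp [strat, Plan.strategy, hκ]
    · refine Or.inr ⟨?_, j, by simp [strat, Plan.strategy, hκ], fun i hi => ?_⟩
      · have hne := (p.select_of_some j hκ (Classical.arbitrary Ω)).1 fun _ => Classical.arbitrary I
        by_contra! hk
        exact hne (Fin.ext (by omega))
      · simp [strat, Plan.strategy, hκ, hi.symm]

end Equilibrium

section Persuasion

theorem mixedUtility_vertex {Ω A : Type*} [Fintype A] [DecidableEq A] (w : A → Ω → ℝ) (a : A) (ω : Ω) :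
    mixedUtility w (stdSimplex.vertex a) ω = w a ω := by
  simp [mixedUtility, Pi.single_apply]

variable {Ω A : Type*} [Fintype Ω] [Fintype A]

theorem eq_zero_of_notMem_usedActions {P : stdSimplex ℝ (A × Ω)} {a : A}
    (ha : a ∉ usedActions P) (ω : Ω) : P.1 (a, ω) = 0 := by
  have h0 : ∑ ω, P.1 (a, ω) = 0 :=
    le_antisymm (not_lt.1 ha) (Finset.sum_nonneg fun ω _ => P.2.1 _)
  exact (Finset.sum_eq_zero_iff_of_nonneg fun ω _ => P.2.1 _).1 h0 ω (Finset.mem_univ ω)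

theorem sum_usedActions {P : stdSimplex ℝ (A × Ω)} [Fintype (usedActions P)] {F : A → ℝ}
    (hF : ∀ a ∉ usedActions P, F a = 0) : ∑ a : usedActions P, F a = ∑ a, F a := by
  classical
  rw [← Finset.sum_subtype (Finset.univ.filter fun a => a ∈ usedActions P) (by simp) F]
  exact Finset.sum_filter_of_ne fun a _ h => by
    by_contra ha
    exact h (hF a ha)

/-- A unique persuasion policy cannot be perturbed by rescaling its rows. -/
theorem eq_zero_of_rescaling {G : Game Ω A} {P : stdSimplex ℝ (A × Ω)}
    (hP : IsPersuasionPolicy G P) (hunique : ∀ P', IsPersuasionPolicy G P' → P' = P)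
    {c : A → ℝ} (hc : ∀ a, |c a| ≤ 1) (h0 : ∀ ω, ∑ a, c a * P.1 (a, ω) = 0)
    (hv : 0 ≤ ∑ a, ∑ ω, c a * (P.1 (a, ω) * G.v a ω)) {a : A} (ha : a ∈ usedActions P) :
    c a = 0 := by
  have hmarg : ∀ ω, ∑ a, (1 + c a) * P.1 (a, ω) = ∑ a, P.1 (a, ω) := fun ω => by
    simp_rw [add_mul, one_mul, Finset.sum_add_distrib, h0, add_zero]
  have hc' : ∀ a, 0 ≤ 1 + c a := fun a => by have := (abs_le.1 (hc a)).1; linarith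
  let P' : stdSimplex ℝ (A × Ω) := ⟨fun z => (1 + c z.1) * P.1 z,
    fun z => mul_nonneg (hc' z.1) (P.2.1 z), by
      rw [Fintype.sum_prod_type_right]
      simp_rw [hmarg]
      rw [← Fintype.sum_prod_type_right, P.2.2]⟩
  have hP' : IsPersuasionPolicy G P' := by
    refine ⟨⟨fun ω => (hmarg ω).trans (hP.1.1 ω), fun a a' => ?_⟩, fun Q hQ =>
      (hP.2 Q hQ).trans ?_⟩
    · change ∑ ω, (1 + c a) * P.1 (a, ω) * G.u a' ω ≤ ∑ ω, (1 + c a) * P.1 (a, ω) * G.u a ω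
      simp_rw [mul_assoc, ← Finset.mul_sum]
      exact mul_le_mul_of_nonneg_left (hP.1.2 a a') (hc' a)
    · change policyValue G P ≤ ∑ a, ∑ ω, (1 + c a) * P.1 (a, ω) * G.v a ω
      simp_rw [add_mul, one_mul, Finset.sum_add_distrib, mul_assoc]
      exact le_add_of_nonneg_right hv
  have heq : ∀ ω, (1 + c a) * P.1 (a, ω) = P.1 (a, ω) := fun ω =>
    congrFun (congrArg Subtype.val (hunique P' hP')) (a, ω)
  have hsum : c a * ∑ ω, P.1 (a, ω) = 0 := by
    rw [Finset.mul_sum]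
    exact Finset.sum_eq_zero fun ω _ => by linarith [heq ω]
  exact (mul_eq_zero.1 hsum).resolve_right (ne_of_gt ha)

/-- A unique persuasion policy does not use more actions than there are states. -/
theorem nonempty_usedActions_embedding {G : Game Ω A} {P : stdSimplex ℝ (A × Ω)}
    (hP : IsPersuasionPolicy G P) (hunique : ∀ P', IsPersuasionPolicy G P' → P' = P) :
    Nonempty (usedActions P ↪ Ω) := by
  classical
  have hli : LinearIndependent ℝ fun (a : usedActions P) (ω : Ω) => P.1 (a.1, ω) := by
    rw [Fintype.linearIndependent_iff]
    intro g hg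
    let c : A → ℝ := fun a => if h : a ∈ usedActions P then g ⟨a, h⟩ else 0
    have hcg : ∀ a : usedActions P, c a = g a := fun a => dif_pos a.2
    have h0 : ∀ ω, ∑ a, c a * P.1 (a, ω) = 0 := by
      intro ω
      rw [← sum_usedActions (P := P) fun a ha => by
        rw [eq_zero_of_notMem_usedActions ha ω, mul_zero]]
      simp_rw [hcg]
      simpa using congrFun hg ω
    set M := 1 + ∑ a, |c a|
    have hM : 0 < M := add_pos_of_pos_of_nonneg one_pos (Finset.sum_nonneg fun a _ => abs_nonneg _)
    have hcM : ∀ a, |c a| ≤ M := fun a =>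
      (Finset.single_le_sum (f := fun a => |c a|) (fun a _ => abs_nonneg _)
        (Finset.mem_univ a)).trans (by simp [M])
    intro a
    have key : ∀ s : ℝ, |s| = M⁻¹ →
        0 ≤ s * ∑ a, ∑ ω, c a * (P.1 (a, ω) * G.v a ω) → g a = 0 := by
      intro s hs hv
      have := eq_zero_of_rescaling hP hunique (c := fun a => s * c a) (fun a => by
          rw [abs_mul, hs, inv_mul_le_iff₀ hM, mul_one]; exact hcM a)
        (fun ω => by simp_rw [mul_assoc, ← Finset.mul_sum, h0, mul_zero])
        (by simpa only [mul_assoc, ← Finset.mul_sum] using hv) a.2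
      rw [← hcg]
      refine (mul_eq_zero.1 this).resolve_left ?_
      exact abs_pos.1 (hs ▸ inv_pos.2 hM)
    rcases le_total 0 (∑ a, ∑ ω, c a * (P.1 (a, ω) * G.v a ω)) with h | h
    · exact key M⁻¹ (abs_of_pos (inv_pos.2 hM)) (mul_nonneg (inv_pos.2 hM).le h)
    · exact key (-M⁻¹) (by rw [abs_neg, abs_of_pos (inv_pos.2 hM)])
        (mul_nonneg_of_nonpos_of_nonpos (neg_nonpos.2 (inv_pos.2 hM).le) h)
  have hcard := hli.fintype_card_le_finrank
  rw [Module.finrank_fintype_fun_eq_card] at hcard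
  exact Function.Embedding.nonempty_of_card_le hcard

theorem isBestReply_vertex [DecidableEq A] {u : A → Ω → ℝ} {q : stdSimplex ℝ Ω} {a : A}
    (h : ∀ a', ∑ ω, q.1 ω * u a' ω ≤ ∑ ω, q.1 ω * u a ω) :
    IsBestReply u q (stdSimplex.vertex a) := by
  intro y
  simp_rw [mixedUtility_vertex]
  calc ∑ ω, q.1 ω * mixedUtility u y ω = ∑ a', y.1 a' * ∑ ω, q.1 ω * u a' ω := by
        simp_rw [mixedUtility, Finset.mul_sum]
        rw [Finset.sum_comm]
        exact Finset.sum_congr rfl fun _ _ => Finset.sum_congr rfl fun _ _ => by ring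
    _ ≤ ∑ a', y.1 a' * ∑ ω, q.1 ω * u a ω :=
        Finset.sum_le_sum fun a' _ => mul_le_mul_of_nonneg_left (h a') (y.2.1 a')
    _ = ∑ ω, q.1 ω * u a ω := by rw [← Finset.sum_mul, y.2.2, one_mul]

end Persuasion

end Disclosure

end

theorem theorem1 {Ω A S : Type*} [Fintype Ω] [Fintype A]
    [MeasurableSpace S] [MeasurableSingletonClass S] (hS : Nonempty (Ω ↪ S))
    (G : Disclosure.Game Ω A) (P : stdSimplex ℝ (A × Ω))
    (hP : Disclosure.IsPersuasionPolicy G P)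
    (hunique : ∀ P', Disclosure.IsPersuasionPolicy G P' → P' = P)
    (hpun : Disclosure.HasPunishingAction G (Disclosure.usedActions P)) :
    ∃ (τ : Disclosure.SenderStrategy Ω S G.ν) (R : Disclosure.Assessment Ω A S G.ν),
      Disclosure.IsWPBE G τ R ∧
      Disclosure.senderPayoff G R τ = Disclosure.policyValue G P ∧
      (∀ T, Disclosure.IsBestReply G.u (R.ρ T) (R.σ T)) ∧
      ∃ π π' : Disclosure.Experiment Ω S, π'.IsFullyRevealing ∧
        ∀ k : G.ν.support, ∀ ψ ∈ (τ k).support,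
          (∀ i, ψ.experiment i = π) ∨
          (1 < (k.1 : ℕ) ∧ ∃ j, ψ.experiment j = π' ∧ ∀ i, i ≠ j → ψ.experiment i = π) := by
  classical
  obtain ⟨f⟩ := hS
  obtain ⟨g⟩ := Disclosure.nonempty_usedActions_embedding hP hunique
  obtain ⟨q, pun, hq, hpun⟩ := hpun
  obtain ⟨⟨a₀, ω₀⟩, h₀⟩ : ∃ z, P.1 z ≠ 0 := by
    by_contra! h
    have := P.2.2
    simp [h] at this
  have : Nonempty Ω := ⟨ω₀⟩
  have : Nonempty (Disclosure.usedActions P) := ⟨⟨a₀, by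
    by_contra h
    exact h₀ (Disclosure.eq_zero_of_notMem_usedActions h ω₀)⟩⟩
  have hp := G.prior_pos
  let y : Ω → stdSimplex ℝ (Disclosure.usedActions P) := fun ω =>
    ⟨fun a => P.1 (a, ω) / G.prior.1 ω, fun a => div_nonneg (P.2.1 _) (hp ω).le, by
      rw [← Finset.sum_div, Disclosure.sum_usedActions (F := fun a => P.1 (a, ω))
        fun a ha => Disclosure.eq_zero_of_notMem_usedActions ha ω, hP.1.1 ω,
        div_self (hp ω).ne']⟩
  have hy : ∀ ω (a : Disclosure.usedActions P), G.prior.1 ω * (y ω).1 a = P.1 (a, ω) :=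
    fun ω a => mul_div_cancel₀ _ (hp ω).ne'
  have hpos : ∀ a : Disclosure.usedActions P, 0 < ∑ ω, P.1 (a.1, ω) := fun a => a.2
  let bel : Disclosure.usedActions P → stdSimplex ℝ Ω := fun a =>
    ⟨fun ω => P.1 (a, ω) / ∑ ω', P.1 (a.1, ω'), fun ω => div_nonneg (P.2.1 _) (hpos a).le, by
      rw [← Finset.sum_div, div_self (hpos a).ne']⟩
  obtain ⟨τ, R, hwpbe, hpay, hrest⟩ := Disclosure.exists_equilibrium_of_punishment G (g.trans f) f y
    bel (fun a => stdSimplex.vertex a.1) q pun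
    (fun a ω => by simp_rw [hy]; exact mul_div_cancel₀ _ (hpos a).ne')
    (fun a => Disclosure.isBestReply_vertex fun a' => by
      simp only [bel, div_mul_eq_mul_div, ← Finset.sum_div]
      exact div_le_div_of_nonneg_right (hP.1.2 a a') (hpos a).le)
    hq (fun a ω => by rw [Disclosure.mixedUtility_vertex]; exact hpun a.1 a.2 ω)
  refine ⟨τ, R, hwpbe, hpay.trans ?_, hrest⟩
  simp_rw [hy, Disclosure.mixedUtility_vertex]
  rw [Disclosure.policyValue, Finset.sum_comm]
  exact Disclosure.sum_usedActions (F := fun a => ∑ ω, P.1 (a, ω) * G.v a ω) fun a ha =>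
    Finset.sum_eq_zero fun ω _ => by
      rw [Disclosure.eq_zero_of_notMem_usedActions ha ω, zero_mul]
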